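/- Throughout, $A$ and $B$ are $\mathbb{Z}/2\mathbb{Z}$-graded $C^*$-algebras (gradings given by $*$-automorphisms of order two) with $A$ separable and $B$ $\sigma$-unital (i.e. $B$ has a countable approximate identity), and $C([0,1],B)$ carries the pointwise grading. A $\mathbb{Z}/2\mathbb{Z}$-graded $C^*$-correspondence from $A$ to a graded $C^*$-algebra $C$ is a graded right Hilbert $C^*$-module over $C$ together with an even $*$-homomorphism from $A$ to its bounded adjointable operators; it is countably generated if it contains a countable subset that generates a norm-dense right $C$-submodule. An operator on a Hilbert $C^*$-module is compact if it lies in the operator norm closure of the span of the rank one operators $\zeta \mapsto \xi\langle \eta,\zeta\rangle$. Let $X$ and $X'$ be countably generated $\mathbb{Z}/2\mathbb{Z}$-graded $C^*$-correspondences from $A$ to $C([0,1],B)$. For $t \in [0,1]$ let ${\rm ev}_t : C([0,1],B) \to B$ be evaluation at $t$, and let $X \widehat\otimes_{{\rm ev}_t} B$ be the interior tensor product. It is identified with the fibre $X/\{\xi : \langle \xi,\xi\rangle(t) = 0\}$ with inner product $\langle [\xi],[\eta]\rangle = \langle \xi,\eta\rangle(t)$, where $\xi \widehat\otimes b$ corresponds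 to the class of $\xi\cdot b$ ($b$ regarded as a constant function), and the class of $\xi$ is written $\xi \widehat\otimes_{{\rm ev}_t} 1$. Let $$U : X \widehat\otimes_{{\rm ev}_1} B \to X' \widehat\otimes_{{\rm ev}_0} B$$ be an even unitary isomorphism of $C^*$-correspondences from $A$ to $B$, and let $$X \times_U X' := \{(\xi,\xi') \in X \oplus X' : U(\xi \widehat\otimes_{{\rm ev}_1} 1) = \xi' \widehat\otimes_{{\rm ev}_0} 1\}$$ be the $\mathbb{Z}/2\mathbb{Z}$-graded $C^*$-correspondence from $A$ to $C([0,1],B)$ with vector space structure, left action and grading inherited from $X \oplus X'$, with right action $(\xi,\xi')\cdot f := (\xi\cdot\beta_0(f), \xi'\cdot\beta_1(f))$, where $\beta_0(f)(t) = f(t/2)$ and $\beta_1(f)(t) = f((t+1)/2)$, and with inner product $$\langle(\xi,\xi'),(\eta,\eta')\rangle(t) := \begin{cases}\langle\xi,\eta\rangle(2t) & t\in[0,1/2],\\ \langle\xi',\eta'\rangle(2t-1) & t\in[1/2,1].\end{cases}$$ Then $X \times_U X'$ is countably generated. Moreover, if $K : X \to X$ and $K' : X' \to X'$ are compact operators with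 $U(K \widehat\otimes_{{\rm ev}_1} 1)U^* = K' \widehat\otimes_{{\rm ev}_0} 1$, then the direct sum $K \oplus K' : X \oplus X' \to X \oplus X'$ restricts to a compact operator $K \oplus K' : X \times_U X' \to X \times_U X'$. -/

import Mathlib

open MulOpposite Filter Topology
open scoped unitInterval

universe u v w w'

set_option linter.unusedSectionVars false

noncomputable section

/-! ### Order on `C([0,1], B)` and basic facts on Hilbert modules

Mathlib's `CStarModule R E` carries an action `r • x` with `⟪x, r • y⟫ = r * ⟪x, y⟫`. A right Hilbert
`C*`-module over `B`, with `⟪x, y b⟫ = ⟪x, y⟫ b`, is therefore a `CStarModule` over the opposite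
algebra `Bᵐᵒᵖ`, where `op b • x` stands for `x b`. -/

section HilbertModule

/-- Evaluation at `t`. -/
def evalHom (R : Type*) [CommSemiring R] {B : Type v} [NonUnitalCStarAlgebra B] [Module R B]
    [ContinuousConstSMul R B] (t : I) : C(I, B) →⋆ₙₐ[R] B where
  toFun f := f t
  map_smul' _ _ := rfl
  map_zero' := rfl
  map_add' _ _ := rfl
  map_mul' _ _ := rfl
  map_star' _ := rfl

theorem continuous_evalHom {B : Type v} [NonUnitalCStarAlgebra B] (t : I) :
    Continuous (evalHom ℝ t : C(I, B) →⋆ₙₐ[ℝ] B) := continuous_eval_const t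

/-- The pointwise order on `C([0,1], B)` is the order of this `C*`-algebra. -/
instance continuousMapStarOrderedRing {B : Type v} [NonUnitalCStarAlgebra B] [PartialOrder B]
    [StarOrderedRing B] : StarOrderedRing C(I, B) := by
  refine StarOrderedRing.of_nonneg_iff' (fun {x y} h z t => ?_) (fun x => ⟨fun hx => ?_, ?_⟩)
  · exact add_le_add_right (h t) (z t)
  · have hsa : ∀ t, IsSelfAdjoint (x t) := fun t => IsSelfAdjoint.of_nonneg (hx t)
    have hx' : IsSelfAdjoint x := ContinuousMap.ext fun t => hsa t
    refine ⟨cfcₙ (fun r : ℝ => √|r|) x, ?_⟩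
    have h1 : IsSelfAdjoint (cfcₙ (fun r : ℝ => √|r|) x) := cfcₙ_predicate _ _
    rw [h1.star_eq, ← cfcₙ_mul (fun r : ℝ => √|r|) (fun r : ℝ => √|r|) x]
    ext t
    let φ : C(I, B) →⋆ₙₐ[ℝ] B := evalHom ℝ t
    have hφ : Continuous φ := continuous_evalHom t
    have := NonUnitalStarAlgHom.map_cfcₙ (R := ℝ) φ (fun r : ℝ => √|r| * √|r|) x
      (hφa := hsa t)
    refine Eq.trans ?_ this.symm
    have e : φ x = x t := rfl
    rw [e]
    conv_lhs => rw [← cfcₙ_id' ℝ (x t) (hsa t)]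
    refine cfcₙ_congr fun r hr => ?_
    have := quasispectrum_nonneg_of_nonneg (x t) (hx t) r hr
    simp [abs_of_nonneg this, Real.mul_self_sqrt this]
  · rintro ⟨s, rfl⟩ t
    exact star_mul_self_nonneg (s t)

variable {B : Type v} [NonUnitalCStarAlgebra B] [PartialOrder B]
  {E : Type w} [NormedAddCommGroup E] [NormedSpace ℂ E] [SMul Bᵐᵒᵖ E] [CStarModule Bᵐᵒᵖ E]

/-- The `B`-valued inner product of a right Hilbert module over `B`. -/
def ip (B : Type v) [NonUnitalCStarAlgebra B] [PartialOrder B] {E : Type w} [NormedAddCommGroup E]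
    [NormedSpace ℂ E] [SMul Bᵐᵒᵖ E] [CStarModule Bᵐᵒᵖ E] (x y : E) : B :=
  unop (inner Bᵐᵒᵖ x y)

theorem ip_add_right (x y z : E) : ip B x (y + z) = ip B x y + ip B x z := by simp [ip]

theorem ip_smul_right (c : ℂ) (x y : E) : ip B x (c • y) = c • ip B x y := by simp [ip]

theorem ip_mul_right (x y : E) (b : B) : ip B x (op b • y) = ip B x y * b := by simp [ip]

theorem star_ip (x y : E) : star (ip B x y) = ip B y x := by
  simp [ip, ← unop_star]

theorem ip_mul_left (x y : E) (b : B) : ip B (op b • x) y = star b * ip B x y := by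
  rw [← star_ip, ip_mul_right, star_mul, star_ip]

theorem ip_add_left (x y z : E) : ip B (x + y) z = ip B x z + ip B y z := by
  rw [← star_ip, ip_add_right, star_add, star_ip, star_ip]

theorem ip_sub_right (x y z : E) : ip B x (y - z) = ip B x y - ip B x z := by simp [ip]

theorem ip_sub_left (x y z : E) : ip B (x - y) z = ip B x z - ip B y z := by simp [ip]

theorem ip_zero_right (x : E) : ip B x 0 = 0 := by simp [ip]

theorem ip_self_nonneg (x : E) : 0 ≤ ip B x x :=
  CStarModule.inner_self_nonneg (A := Bᵐᵒᵖ) (x := x)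

theorem ip_self_eq_zero {x : E} : ip B x x = 0 ↔ x = 0 := by
  rw [ip, unop_eq_zero_iff, CStarModule.inner_self]

theorem norm_sq_eq_ip (x : E) : ‖x‖ ^ 2 = ‖ip B x x‖ := CStarModule.norm_sq_eq Bᵐᵒᵖ

theorem ip_ext {x y : E} (h : ∀ z, ip B z x = ip B z y) : x = y := by
  rw [← sub_eq_zero, ← ip_self_eq_zero (B := B), ip_sub_right, h, sub_self]

variable (E) in
/-- Right multiplication by `b`, as a linear map. -/
def rmul (b : B) : E →ₗ[ℂ] E where
  toFun x := op b • x
  map_add' x y := ip_ext (B := B) fun z => by simp only [ip_mul_right, ip_add_right, add_mul]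
  map_smul' c x := ip_ext (B := B) fun z => by
    simp only [ip_mul_right, ip_smul_right, RingHom.id_apply, smul_mul_assoc]

theorem norm_op_smul_le (b : B) (x : E) : ‖op b • x‖ ≤ ‖x‖ * ‖b‖ := by
  refine le_of_sq_le_sq ?_ (by positivity)
  rw [norm_sq_eq_ip (B := B), ip_mul_right, ip_mul_left, mul_pow, norm_sq_eq_ip (B := B)]
  calc ‖star b * ip B x x * b‖ ≤ ‖star b‖ * ‖ip B x x‖ * ‖b‖ :=
        (norm_mul_le _ _).trans (by gcongr; exact norm_mul_le _ _)
    _ = ‖ip B x x‖ * ‖b‖ ^ 2 := by rw [norm_star]; ring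

section

variable [StarOrderedRing B]

theorem norm_ip_le (x y : E) : ‖ip B x y‖ ≤ ‖x‖ * ‖y‖ :=
  @CStarModule.norm_inner_le Bᵐᵒᵖ E _ _ _ _ _ _ _ _ x y

/-- Every vector is almost reproduced by some element of the algebra, with control of that
element under `*`-homomorphisms. -/
theorem exists_approx (ξ : E) {r : ℝ} (hr : 0 < r) : ∃ g : B, ‖ξ - op g • ξ‖ ^ 2 ≤ r ∧
    ∀ {C : Type v} [NonUnitalCStarAlgebra C] [PartialOrder C] [StarOrderedRing C]
      (φ : B →⋆ₙₐ[ℝ] C), Continuous φ → 0 ≤ φ (ip B ξ ξ) → ‖φ (ip B ξ ξ)‖ ≤ r → φ g = 0 := by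
  have hmax : ∀ x : ℝ, 0 < max r x := fun x => lt_max_of_lt_left hr
  obtain ⟨h, hc, h_zero, h_eq⟩ : ∃ h : ℝ → ℝ, Continuous h ∧ (∀ x, x ≤ r → h x = 0) ∧
      ∀ x, (x - x * h x) - h x * (x - x * h x) = r * (x / max r x) := by
    refine ⟨fun x => 1 - √(r / max r x), ?_, fun x hx => ?_, fun x => ?_⟩
    · refine continuous_const.sub (Real.continuous_sqrt.comp (continuous_const.div ?_ ?_))
      · fun_prop
      · exact fun x => (hmax x).ne'
    · simp [max_eq_left hx, div_self hr.ne']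
    · have : √(r / max r x) ^ 2 = r / max r x :=
        Real.sq_sqrt (div_nonneg hr.le (hmax x).le)
      calc _ = x * √(r / max r x) ^ 2 := by ring
        _ = _ := by rw [this]; ring
  have h0 : h 0 = 0 := h_zero 0 hr.le
  have ha : 0 ≤ ip B ξ ξ := ip_self_nonneg ξ
  have hsa : IsSelfAdjoint (ip B ξ ξ) := IsSelfAdjoint.of_nonneg ha
  refine ⟨cfcₙ h (ip B ξ ξ), ?_, ?_⟩
  · have hg : IsSelfAdjoint (cfcₙ h (ip B ξ ξ)) := cfcₙ_predicate _ _
    have hid : cfcₙ (fun x : ℝ => x) (ip B ξ ξ) = ip B ξ ξ := cfcₙ_id' ℝ _ hsa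
    have key : ip B (ξ - op (cfcₙ h (ip B ξ ξ)) • ξ) (ξ - op (cfcₙ h (ip B ξ ξ)) • ξ) =
        cfcₙ (fun x : ℝ => (x - x * h x) - h x * (x - x * h x)) (ip B ξ ξ) := by
      rw [cfcₙ_sub (fun x : ℝ => x - x * h x) (fun x : ℝ => h x * (x - x * h x)),
        cfcₙ_mul h (fun x : ℝ => x - x * h x), cfcₙ_sub (fun x : ℝ => x) (fun x : ℝ => x * h x),
        cfcₙ_mul (fun x : ℝ => x) h, hid]
      simp only [ip_sub_left, ip_sub_right, ip_mul_left, ip_mul_right, hg.star_eq]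
      noncomm_ring
    rw [norm_sq_eq_ip (B := B), key]
    refine norm_cfcₙ_le fun x hx => ?_
    have hx0 : 0 ≤ x := quasispectrum_nonneg_of_nonneg _ ha x hx
    have hq : x / max r x ≤ 1 := (div_le_one (hmax x)).2 (le_max_right _ _)
    rw [h_eq, Real.norm_of_nonneg (mul_nonneg hr.le (div_nonneg hx0 (hmax x).le))]
    exact mul_le_of_le_one_right hr.le hq
  · intro C _ _ _ φ hφ hpos hle
    have hsa' : IsSelfAdjoint (φ (ip B ξ ξ)) := IsSelfAdjoint.of_nonneg hpos
    rw [NonUnitalStarAlgHom.map_cfcₙ (R := ℝ) φ h (ip B ξ ξ) (hφa := hsa'),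
      ← cfcₙ_zero ℝ (φ (ip B ξ ξ))]
    refine cfcₙ_congr fun x hx => h_zero x ?_
    have := NonUnitalIsometricContinuousFunctionalCalculus.norm_quasispectrum_le
      (𝕜 := ℝ) (φ (ip B ξ ξ)) hx hsa'
    exact (le_abs_self x).trans (this.trans hle)

/-- The rank one operator `z ↦ x ⟪y, z⟫`. -/
def rankOne (B : Type v) [NonUnitalCStarAlgebra B] [PartialOrder B]
    [StarOrderedRing B] {E : Type w} [NormedAddCommGroup E] [NormedSpace ℂ E] [SMul Bᵐᵒᵖ E]
    [CStarModule Bᵐᵒᵖ E] (x y : E) : E →L[ℂ] E :=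
  LinearMap.mkContinuous
    { toFun := fun z => op (ip B y z) • x
      map_add' := fun a b => ip_ext (B := B) fun z => by
        simp only [ip_mul_right, ip_add_right, mul_add]
      map_smul' := fun c a => ip_ext (B := B) fun z => by
        simp only [ip_mul_right, ip_smul_right, RingHom.id_apply, mul_smul_comm] }
    (‖x‖ * ‖y‖) fun z => by
      refine (norm_op_smul_le _ _).trans ?_
      rw [mul_assoc]
      gcongr
      exact norm_ip_le y z

end

end HilbertModule

/-! ### Graded `C*`-algebras and graded `C*`-correspondences -/

/-- A `ℤ/2`-grading on a `C*`-algebra, given by the grading operator (`1` on the even part,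
`-1` on the odd part): a `*`-automorphism of order two. -/
class GradedCStarAlgebra (A : Type u) [NonUnitalCStarAlgebra A] where
  grading : A →⋆ₙₐ[ℂ] A
  grading_grading : ∀ a, grading (grading a) = a

/-- The pointwise grading on `C([0,1], B)`. -/
instance {B : Type v} [NonUnitalCStarAlgebra B] [GradedCStarAlgebra B] :
    GradedCStarAlgebra C(I, B) where
  grading :=
    { toFun := fun f => ⟨fun t => GradedCStarAlgebra.grading (f t),
        (AddMonoidHomClass.continuous_of_bound (GradedCStarAlgebra.grading : B →⋆ₙₐ[ℂ] B) 1
          (by simpa only [one_mul] using NonUnitalStarAlgHom.norm_apply_le _)).comp f.continuous⟩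
      map_smul' := fun c f => by ext t; exact map_smul GradedCStarAlgebra.grading c (f t)
      map_zero' := by ext t; exact map_zero (GradedCStarAlgebra.grading : B →⋆ₙₐ[ℂ] B)
      map_add' := fun f g => by ext t; exact map_add GradedCStarAlgebra.grading (f t) (g t)
      map_mul' := fun f g => by ext t; exact map_mul GradedCStarAlgebra.grading (f t) (g t)
      map_star' := fun f => by ext t; exact map_star GradedCStarAlgebra.grading (f t) }
  grading_grading f := by ext t; exact GradedCStarAlgebra.grading_grading (f t)

/-- A `C*`-algebra is `σ`-unital if it has a countable approximate identity. -/
def IsSigmaUnital (B : Type v) [NonUnitalCStarAlgebra B] : Prop :=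
  ∃ e : ℕ → B, ∀ b : B, Tendsto (fun n => e n * b) atTop (𝓝 b) ∧
    Tendsto (fun n => b * e n) atTop (𝓝 b)

/-- A `ℤ/2`-graded `C*`-correspondence from `A` to `B`: a right Hilbert `C*`-module over `B` with a
`*`-homomorphism `left` from `A` to the adjointable operators and a compatible grading operator. -/
structure GradedCorrespondence (A : Type u) (B : Type v) [NonUnitalCStarAlgebra A]
    [GradedCStarAlgebra A] [NonUnitalCStarAlgebra B] [PartialOrder B] [GradedCStarAlgebra B] where
  carrier : Type w
  [normedAddCommGroup : NormedAddCommGroup carrier]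
  [normedSpace : NormedSpace ℂ carrier]
  [completeSpace : CompleteSpace carrier]
  [smul : SMul Bᵐᵒᵖ carrier]
  [cstarModule : CStarModule Bᵐᵒᵖ carrier]
  left : A →ₙₐ[ℂ] Module.End ℂ carrier
  ip_left : ∀ a x y, ip B (left a x) y = ip B x (left (star a) y)
  grading : carrier →ₗ[ℂ] carrier
  grading_grading : ∀ x, grading (grading x) = x
  grading_left : ∀ a x, grading (left a x) = left (GradedCStarAlgebra.grading a) (grading x)
  grading_mul : ∀ (b : B) x,
    grading (op b • x) = op (GradedCStarAlgebra.grading b) • grading x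
  ip_grading : ∀ x y, ip B (grading x) (grading y) = GradedCStarAlgebra.grading (ip B x y)

namespace GradedCorrespondence

attribute [instance] normedAddCommGroup normedSpace completeSpace smul cstarModule

variable {A : Type u} {B : Type v} [NonUnitalCStarAlgebra A] [GradedCStarAlgebra A]
  [NonUnitalCStarAlgebra B] [PartialOrder B] [GradedCStarAlgebra B]

instance : CoeSort (GradedCorrespondence.{u, v, w} A B) (Type w) := ⟨carrier⟩

/-- `X` is countably generated: for some countable set `S ⊆ X`, the right submodule generated by
`S` is norm-dense in `X`. -/
def IsCountablyGenerated (X : GradedCorrespondence.{u, v, w} A B) : Prop :=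
  ∃ S : Set X, S.Countable ∧
    Dense (Submodule.span ℂ {y : X | ∃ x ∈ S, ∃ b : B, y = op b • x} : Set X)

/-- Bounded adjointable operators on `X`. -/
structure Adjointable (X : GradedCorrespondence.{u, v, w} A B) where
  toCLM : X →L[ℂ] X
  exists_adjoint : ∃ S : X →L[ℂ] X, ∀ x y, ip B (toCLM x) y = ip B x (S y)

instance (X : GradedCorrespondence.{u, v, w} A B) : CoeFun X.Adjointable (fun _ => X → X) :=
  ⟨fun T => T.toCLM⟩

/-- `T` is compact: it lies in the operator norm closure of the span of the rank one operators. -/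
def Adjointable.IsCompact [StarOrderedRing B] {X : GradedCorrespondence.{u, v, w} A B}
    (T : X.Adjointable) : Prop :=
  T.toCLM ∈ closure
    (Submodule.span ℂ {R : X →L[ℂ] X | ∃ x y : X, R = rankOne B x y} : Set (X →L[ℂ] X))

/-- An even unitary isomorphism of `ℤ/2`-graded `C*`-correspondences from `A` to `B`. -/
structure EvenUnitary (X : GradedCorrespondence.{u, v, w} A B)
    (Y : GradedCorrespondence.{u, v, w'} A B) where
  toEquiv : X ≃ₗ[ℂ] Y
  map_mul : ∀ (b : B) (x : X), toEquiv (op b • x) = op b • toEquiv x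
  map_ip : ∀ x y : X, ip B (toEquiv x) (toEquiv y) = ip B x y
  map_left : ∀ (a : A) (x : X), toEquiv (X.left a x) = Y.left a (toEquiv x)
  map_grading : ∀ x : X, toEquiv (X.grading x) = Y.grading (toEquiv x)

/-! ### The interior tensor product along an evaluation

For `ev_t : C([0,1], B) → B` the interior tensor product of `X` with `B` along `ev_t` is realised
as the fibre `X ⧸ {ξ | ⟪ξ, ξ⟫(t) = 0}` with inner product `⟪[ξ], [η]⟫ = ⟪ξ, η⟫(t)`. The elementary
tensor `ξ ⊗ b` is the class of `ξ b` (with `b` a constant function), and the class of `ξ` is `ξ ⊗ 1`.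
The facts `ip_tmul`, `dense_span_tmul` (together with the completeness of the fibre and the
descriptions of the actions below) say that this is the interior tensor product. -/

section Fibre

variable [StarOrderedRing B] (X : GradedCorrespondence.{u, v, w} A C(I, B)) (t : I)

/-- If `⟪ξ, ξ⟫(t) = 0` then `⟪η, ξ⟫(t) = 0` for all `η`. -/
theorem ip_apply_eq_zero {X : GradedCorrespondence.{u, v, w} A C(I, B)} {t : I} {ξ : X}
    (h : ip C(I, B) ξ ξ t = 0) (η : X) : ip C(I, B) η ξ t = 0 := by
  have h1 : ip C(I, B) ξ η * ip C(I, B) η ξ ≤ ‖η‖ ^ 2 • ip C(I, B) ξ ξ :=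
    CStarModule.inner_mul_inner_swap_le (A := C(I, B)ᵐᵒᵖ) (x := η) (y := ξ)
  have h2 : (ip C(I, B) ξ η * ip C(I, B) η ξ) t ≤ (‖η‖ ^ 2 • ip C(I, B) ξ ξ) t := h1 t
  rw [ContinuousMap.mul_apply, ContinuousMap.smul_apply, h, smul_zero, ← star_ip,
    ContinuousMap.star_apply] at h2
  exact (CStarRing.star_mul_self_eq_zero_iff _).1 (le_antisymm h2 (star_mul_self_nonneg _))

/-- The vectors that vanish at `t`. -/
def vanishing : Submodule ℂ X where
  carrier := {ξ | ip C(I, B) ξ ξ t = 0}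
  zero_mem' := by simp [ip_zero_right]
  add_mem' {ξ η} hξ hη := by
    rw [Set.mem_ofPred_eq, ip_add_right, ContinuousMap.add_apply, ip_apply_eq_zero hξ,
      ip_apply_eq_zero hη, add_zero]
  smul_mem' c ξ hξ := by
    rw [Set.mem_ofPred_eq, ip_smul_right, ContinuousMap.smul_apply, ip_apply_eq_zero hξ, smul_zero]

theorem mem_vanishing {ξ : X} : ξ ∈ X.vanishing t ↔ ip C(I, B) ξ ξ t = 0 := Iff.rfl

theorem mem_vanishing' {ξ : X} : ξ ∈ X.vanishing t ↔ ∀ η, ip C(I, B) η ξ t = 0 :=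
  ⟨ip_apply_eq_zero, fun h => h ξ⟩

theorem continuous_ip_self_apply : Continuous fun ξ : X => ip C(I, B) ξ ξ t := by
  have : Continuous fun ξ : X => inner C(I, B)ᵐᵒᵖ ξ ξ :=
    (CStarModule.continuous_inner (A := C(I, B)ᵐᵒᵖ) (E := X)).comp (continuous_id.prodMk continuous_id)
  exact (continuous_eval_const t).comp (continuous_unop.comp this)

instance isClosed_vanishing : IsClosed (X.vanishing t : Set X) :=
  isClosed_eq (X.continuous_ip_self_apply t) continuous_const

/-- The quotient norm of the fibre is the norm of the inner product `⟪ξ, ξ⟫(t)`. -/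
theorem norm_mk_eq (ξ : X) :
    ‖(Submodule.Quotient.mk ξ : X ⧸ X.vanishing t)‖ = √‖ip C(I, B) ξ ξ t‖ := by
  refine le_antisymm (le_of_forall_pos_le_add fun ε hε => ?_) ?_
  · have hr : 0 < (√‖ip C(I, B) ξ ξ t‖ + ε) ^ 2 := by positivity
    obtain ⟨g, hg, hg'⟩ := exists_approx (B := C(I, B)) ξ hr
    have hgt : g t = 0 := hg' (evalHom ℝ t) (continuous_evalHom t) (ip_self_nonneg (B := C(I, B)) ξ t) (by
      calc ‖ip C(I, B) ξ ξ t‖ = √‖ip C(I, B) ξ ξ t‖ ^ 2 := (Real.sq_sqrt (norm_nonneg _)).symm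
        _ ≤ _ := by gcongr; linarith)
    have hmem : op g • ξ ∈ X.vanishing t := by
      rw [mem_vanishing, ip_mul_right, ContinuousMap.mul_apply, hgt, mul_zero]
    have e : (Submodule.Quotient.mk ξ : X ⧸ X.vanishing t) =
        Submodule.Quotient.mk (ξ - op g • ξ) :=
      (Submodule.Quotient.eq _).2 (by simpa using hmem)
    rw [e]
    exact (Submodule.Quotient.norm_mk_le _ _).trans (le_of_sq_le_sq hg (by positivity))
  · refine le_of_forall_pos_le_add fun ε hε => ?_
    obtain ⟨η, hη, hη'⟩ := Submodule.Quotient.norm_mk_lt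
      (Submodule.Quotient.mk ξ : X ⧸ X.vanishing t) hε
    have h1 : ip C(I, B) ξ ξ t = ip C(I, B) η η t := by
      have hm : η - ξ ∈ X.vanishing t := (Submodule.Quotient.eq _).1 hη
      have h2 := (X.mem_vanishing' t).1 hm
      have h3 := h2 η
      have h4 := congrArg star (h2 ξ)
      rw [ip_sub_right, ContinuousMap.sub_apply, sub_eq_zero] at h3
      rw [ip_sub_right, ContinuousMap.sub_apply, star_sub, star_zero, sub_eq_zero,
        ← ContinuousMap.star_apply, ← ContinuousMap.star_apply, star_ip, star_ip] at h4
      rw [h3, h4]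
    rw [h1]
    refine le_trans ?_ hη'.le
    refine Real.sqrt_le_left (norm_nonneg _) |>.2 ?_ 
    rw [norm_sq_eq_ip (B := C(I, B))]
    exact ContinuousMap.norm_coe_le_norm _ t

theorem ip_apply_congr {ξ ξ' η η' : X} (h : ξ - ξ' ∈ X.vanishing t) (h' : η - η' ∈ X.vanishing t) :
    ip C(I, B) ξ η t = ip C(I, B) ξ' η' t := by
  have h1 := congrArg star ((X.mem_vanishing' t).1 h η)
  have h2 := (X.mem_vanishing' t).1 h' ξ'
  rw [ip_sub_right, ContinuousMap.sub_apply, star_sub, star_zero, sub_eq_zero,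
    ← ContinuousMap.star_apply, ← ContinuousMap.star_apply, star_ip, star_ip] at h1
  rw [ip_sub_right, ContinuousMap.sub_apply, sub_eq_zero] at h2
  rw [h1, h2]

theorem op_smul_mem_vanishing (f : C(I, B)) {ξ : X} (h : ξ ∈ X.vanishing t) :
    op f • ξ ∈ X.vanishing t := by
  rw [mem_vanishing'] at h ⊢
  intro η
  rw [ip_mul_right, ContinuousMap.mul_apply, h, zero_mul]

theorem left_mem_vanishing (a : A) {ξ : X} (h : ξ ∈ X.vanishing t) :
    X.left a ξ ∈ X.vanishing t := by
  rw [mem_vanishing'] at h ⊢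
  intro η
  rw [← star_star a, ← X.ip_left, h]

theorem grading_mem_vanishing {ξ : X} (h : ξ ∈ X.vanishing t) : X.grading ξ ∈ X.vanishing t := by
  rw [mem_vanishing] at h ⊢
  rw [X.ip_grading]
  exact (congrArg GradedCStarAlgebra.grading h).trans (map_zero _)

/-- The right action of `B` on the fibre: `[ξ] b = [ξ b]`, with `b` a constant function. -/
@[reducible]
def fibreSMul : SMul Bᵐᵒᵖ (X ⧸ X.vanishing t) where
  smul b := (X.vanishing t).mapQ (X.vanishing t) (rmul X (ContinuousMap.const I (unop b)))
    fun _ h => X.op_smul_mem_vanishing t _ h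

/-- The inner product of the fibre: `⟪[ξ], [η]⟫ = ⟪ξ, η⟫(t)`. -/
@[reducible]
def fibreInner : Inner Bᵐᵒᵖ (X ⧸ X.vanishing t) where
  inner p q := Quotient.liftOn₂' p q (fun ξ η => op (ip C(I, B) ξ η t)) fun _ _ _ _ h h' =>
    congrArg op (X.ip_apply_congr t ((Submodule.quotientRel_def _).1 h)
      ((Submodule.quotientRel_def _).1 h'))

/-- The interior tensor product of `X` with `B` along evaluation at `t`, realised as the fibre of
`X` at `t`. -/
def fibre : GradedCorrespondence.{u, v, w} A B :=
  letI : SMul Bᵐᵒᵖ (X ⧸ X.vanishing t) := X.fibreSMul t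
  letI : CStarModule Bᵐᵒᵖ (X ⧸ X.vanishing t) :=
    { X.fibreInner t with
      inner_add_right := by
        rintro ⟨x⟩ ⟨y⟩ ⟨z⟩
        exact congrArg (fun f : C(I, B) => op (f t)) (ip_add_right x y z)
      inner_self_nonneg := by
        rintro ⟨x⟩
        exact ip_self_nonneg (B := C(I, B)) x t
      inner_self := by
        rintro ⟨x⟩
        exact (op_eq_zero_iff _).trans (Submodule.Quotient.mk_eq_zero (X.vanishing t) (x := x)).symm
      inner_op_smul_right := by
        rintro b ⟨x⟩ ⟨y⟩
        exact congrArg (fun f : C(I, B) => op (f t)) (ip_mul_right x y _)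
      inner_smul_right_complex := by
        rintro c ⟨x⟩ ⟨y⟩
        exact congrArg (fun f : C(I, B) => op (f t)) (ip_smul_right c x y)
      star_inner := by
        rintro ⟨x⟩ ⟨y⟩
        exact congrArg (fun f : C(I, B) => op (f t)) (star_ip x y)
      norm_eq_sqrt_norm_inner_self := by
        rintro ⟨x⟩
        exact X.norm_mk_eq t x }
  { carrier := X ⧸ X.vanishing t
    left :=
      { toFun := fun a => (X.vanishing t).mapQ (X.vanishing t) (X.left a)
          fun _ h => X.left_mem_vanishing t a h
        map_smul' := fun c a => by ext x; simp
        map_zero' := by ext x; simp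
        map_add' := fun a b => by ext x; simp
        map_mul' := fun a b => by ext x; simp }
    ip_left := by
      rintro a ⟨x⟩ ⟨y⟩
      exact congrArg (fun f : C(I, B) => f t) (X.ip_left a x y)
    grading := (X.vanishing t).mapQ (X.vanishing t) X.grading
      fun _ h => X.grading_mem_vanishing t h
    grading_grading := by
      rintro ⟨x⟩
      exact congrArg Submodule.Quotient.mk (X.grading_grading x)
    grading_left := by
      rintro a ⟨x⟩
      exact congrArg Submodule.Quotient.mk (X.grading_left a x)
    grading_mul := by
      rintro b ⟨x⟩
      exact congrArg Submodule.Quotient.mk (X.grading_mul _ x)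
    ip_grading := by
      rintro ⟨x⟩ ⟨y⟩
      exact congrArg (fun f : C(I, B) => f t) (X.ip_grading x y) }

variable {X}

/-- The class `ξ ⊗ 1` of `ξ` in the fibre at `t`. -/
def toFibre (X : GradedCorrespondence.{u, v, w} A C(I, B)) (t : I) : X →ₗ[ℂ] X.fibre t :=
  (X.vanishing t).mkQ

theorem toFibre_surjective : Function.Surjective (X.toFibre t) := Submodule.mkQ_surjective _

theorem ip_toFibre (ξ η : X) : ip B (X.toFibre t ξ) (X.toFibre t η) = ip C(I, B) ξ η t := rfl

theorem left_toFibre (a : A) (ξ : X) :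
    (X.fibre t).left a (X.toFibre t ξ) = X.toFibre t (X.left a ξ) := rfl

theorem grading_toFibre (ξ : X) :
    (X.fibre t).grading (X.toFibre t ξ) = X.toFibre t (X.grading ξ) := rfl

theorem toFibre_mul (f : C(I, B)) (ξ : X) :
    X.toFibre t (op f • ξ) = op (f t) • X.toFibre t ξ := by
  refine ip_ext (B := B) fun z => ?_
  obtain ⟨η, rfl⟩ := toFibre_surjective t z
  rw [ip_mul_right, ip_toFibre, ip_toFibre, ip_mul_right, ContinuousMap.mul_apply]

/-- The elementary tensor `ξ ⊗ b` in the fibre at `t`. -/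
def tmul (X : GradedCorrespondence.{u, v, w} A C(I, B)) (t : I) (ξ : X) (b : B) : X.fibre t :=
  X.toFibre t (op (ContinuousMap.const I b) • ξ)

theorem tmul_eq (ξ : X) (b : B) : X.tmul t ξ b = op b • X.toFibre t ξ := toFibre_mul t _ ξ

theorem ip_tmul (ξ η : X) (b c : B) :
    ip B (X.tmul t ξ b) (X.tmul t η c) = star b * ip C(I, B) ξ η t * c := by
  rw [tmul_eq, tmul_eq, ip_mul_right, ip_mul_left, ip_toFibre]

theorem tmul_mul (ξ : X) (b c : B) : op c • X.tmul t ξ b = X.tmul t ξ (b * c) := by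
  refine ip_ext (B := B) fun z => ?_
  rw [tmul_eq, tmul_eq, ip_mul_right, ip_mul_right, ip_mul_right, mul_assoc]

theorem mul_tmul (f : C(I, B)) (ξ : X) (b : B) : X.tmul t (op f • ξ) b = X.tmul t ξ (f t * b) := by
  rw [tmul_eq, toFibre_mul, ← tmul_mul, tmul_eq]

theorem left_tmul (a : A) (ξ : X) (b : B) :
    (X.fibre t).left a (X.tmul t ξ b) = X.tmul t (X.left a ξ) b := by
  refine ip_ext (B := B) fun z => ?_
  rw [tmul_eq, tmul_eq, ← star_star a, ← (X.fibre t).ip_left, ip_mul_right, ip_mul_right,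
    (X.fibre t).ip_left, star_star, left_toFibre]

theorem grading_tmul (ξ : X) (b : B) :
    (X.fibre t).grading (X.tmul t ξ b) =
      X.tmul t (X.grading ξ) (GradedCStarAlgebra.grading b) := by
  rw [tmul_eq, tmul_eq, (X.fibre t).grading_mul, grading_toFibre]

theorem continuous_toFibre : Continuous (X.toFibre t) :=
  AddMonoidHomClass.continuous_of_bound (X.toFibre t) 1 fun ξ => by
    rw [one_mul]
    exact Submodule.Quotient.norm_mk_le _ ξ

/-- The elementary tensors span a dense subspace. -/
theorem dense_span_tmul :
    Dense (Submodule.span ℂ {p : X.fibre t | ∃ ξ b, p = X.tmul t ξ b} : Set (X.fibre t)) := by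
  refine Dense.mono Submodule.subset_span fun p => ?_
  obtain ⟨ξ, rfl⟩ := toFibre_surjective t p
  refine Metric.mem_closure_iff.2 fun ε hε => ?_
  obtain ⟨g, hg, -⟩ := exists_approx (B := C(I, B)) ξ (r := (ε / 2) ^ 2) (by positivity)
  refine ⟨_, ⟨ξ, g t, rfl⟩, ?_⟩
  rw [tmul_eq, ← toFibre_mul, dist_eq_norm, ← map_sub]
  calc _ ≤ ‖ξ - op g • ξ‖ := Submodule.Quotient.norm_mk_le _ _
    _ ≤ ε / 2 := le_of_sq_le_sq hg (by positivity)
    _ < ε := by linarith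

/-- The operator on the fibre induced by an operator that preserves the vectors vanishing at `t`. -/
def fibreMap (T : X →L[ℂ] X) (hT : ∀ ξ ∈ X.vanishing t, T ξ ∈ X.vanishing t) :
    X.fibre t →L[ℂ] X.fibre t :=
  LinearMap.mkContinuous
    ((X.vanishing t).mapQ (X.vanishing t) T.toLinearMap hT : X.fibre t →ₗ[ℂ] X.fibre t) ‖T‖ <| by
      intro p
      refine le_of_forall_pos_le_add fun ε hε => ?_
      obtain ⟨ξ, rfl, hξ⟩ := Submodule.Quotient.norm_mk_lt (S := X.vanishing t) p
        (ε := ε / (‖T‖ + 1)) (by positivity)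
      calc _ ≤ ‖T ξ‖ := Submodule.Quotient.norm_mk_le _ _
        _ ≤ ‖T‖ * ‖ξ‖ := T.le_opNorm ξ
        _ ≤ ‖T‖ * (‖(Submodule.Quotient.mk ξ : X ⧸ X.vanishing t)‖ + ε / (‖T‖ + 1)) := by gcongr
        _ ≤ ‖T‖ * ‖(Submodule.Quotient.mk ξ : X ⧸ X.vanishing t)‖ +
            (‖T‖ + 1) * (ε / (‖T‖ + 1)) := by rw [mul_add]; gcongr; linarith
        _ = _ := by rw [mul_div_cancel₀ _ (by positivity)]; rfl

theorem fibreMap_toFibre (T : X →L[ℂ] X) (hT : ∀ ξ ∈ X.vanishing t, T ξ ∈ X.vanishing t) (ξ : X) :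
    fibreMap t T hT (X.toFibre t ξ) = X.toFibre t (T ξ) := rfl

theorem adjointable_mem_vanishing {T S : X →L[ℂ] X}
    (h : ∀ ξ η, ip C(I, B) (T ξ) η = ip C(I, B) ξ (S η)) :
    (∀ ξ ∈ X.vanishing t, T ξ ∈ X.vanishing t) ∧ ∀ ξ ∈ X.vanishing t, S ξ ∈ X.vanishing t := by
  simp only [mem_vanishing']
  refine ⟨fun ξ hξ η => ?_, fun ξ hξ η => ?_⟩
  · rw [← star_ip, h, star_ip, hξ]
  · rw [← h, hξ]

/-- The operator `T ⊗ 1` on the fibre at `t`, given by `(T ⊗ 1) [ξ] = [T ξ]`. -/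
def Adjointable.fibre (T : X.Adjointable) (t : I) : (X.fibre t).Adjointable where
  toCLM := fibreMap t T.toCLM (by
    obtain ⟨S, hS⟩ := T.exists_adjoint
    exact (adjointable_mem_vanishing t hS).1)
  exists_adjoint := by
    obtain ⟨S, hS⟩ := T.exists_adjoint
    refine ⟨fibreMap t S (adjointable_mem_vanishing t hS).2, fun p q => ?_⟩
    obtain ⟨ξ, rfl⟩ := toFibre_surjective t p
    obtain ⟨η, rfl⟩ := toFibre_surjective t q
    rw [fibreMap_toFibre, fibreMap_toFibre, ip_toFibre, ip_toFibre, hS]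

theorem Adjointable.fibre_toFibre (T : X.Adjointable) (ξ : X) :
    T.fibre t (X.toFibre t ξ) = X.toFibre t (T ξ) := rfl

theorem Adjointable.fibre_tmul (T : X.Adjointable) (ξ : X) (b : B) :
    T.fibre t (X.tmul t ξ b) = X.tmul t (T ξ) b := by
  obtain ⟨S, hS⟩ := T.exists_adjoint
  refine congrArg (X.toFibre t) (ip_ext (B := C(I, B)) fun z => ?_)
  rw [← star_ip]
  refine (congrArg star (hS _ _)).trans ?_
  rw [ip_mul_left, star_mul, star_star, star_ip, ip_mul_right]
  congr 1
  rw [← star_ip, ← hS, star_ip]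

end Fibre

/-! ### Glueing -/

section Glue

/-- The map `t ↦ t / 2`. -/
def firstHalf : C(I, I) where
  toFun t := ⟨(t : ℝ) / 2, by constructor <;> linarith [t.2.1, t.2.2]⟩
  continuous_toFun := by fun_prop

/-- The map `t ↦ (t + 1) / 2`. -/
def secondHalf : C(I, I) where
  toFun t := ⟨((t : ℝ) + 1) / 2, by constructor <;> linarith [t.2.1, t.2.2]⟩
  continuous_toFun := by fun_prop

theorem half_eq : firstHalf 1 = secondHalf 0 := Subtype.ext (by simp [firstHalf, secondHalf])

/-- `β₀(f)(t) = f(t / 2)`. -/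
def beta0 (f : C(I, B)) : C(I, B) := f.comp firstHalf

/-- `β₁(f)(t) = f((t + 1) / 2)`. -/
def beta1 (f : C(I, B)) : C(I, B) := f.comp secondHalf

/-- The function `t ↦ f(2t)` for `t ≤ 1/2`, `t ↦ g(2t - 1)` for `t ≥ 1/2`. -/
def concat (f g : C(I, B)) (h : f 1 = g 0) : C(I, B) where
  toFun t := if (t : ℝ) ≤ 1 / 2 then f (Set.projIcc 0 1 zero_le_one (2 * t))
    else g (Set.projIcc 0 1 zero_le_one (2 * t - 1))
  continuous_toFun := by
    refine Continuous.if_le ?_ ?_ continuous_subtype_val continuous_const ?_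
    · exact f.continuous.comp (continuous_projIcc.comp (by fun_prop))
    · exact g.continuous.comp (continuous_projIcc.comp (by fun_prop))
    · intro t ht
      rw [ht]
      norm_num
      exact h

theorem beta0_concat (f g : C(I, B)) (h : f 1 = g 0) : beta0 (concat f g h) = f := by
  ext t
  have ht : (firstHalf t : ℝ) = t / 2 := rfl
  have h1 : (firstHalf t : ℝ) ≤ 1 / 2 := by linarith [t.2.2]
  have h2 : 2 * (firstHalf t : ℝ) = t := by linarith
  simp only [beta0, concat, ContinuousMap.comp_apply, ContinuousMap.coe_mk, if_pos h1, h2,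
    Set.projIcc_val]

theorem beta1_concat (f g : C(I, B)) (h : f 1 = g 0) : beta1 (concat f g h) = g := by
  ext t
  have ht : (secondHalf t : ℝ) = (t + 1) / 2 := rfl
  have h2 : 2 * (secondHalf t : ℝ) - 1 = t := by linarith
  simp only [beta1, concat, ContinuousMap.comp_apply, ContinuousMap.coe_mk]
  split_ifs with h1
  · have ht0 : t = 0 := Subtype.ext (le_antisymm (show (t : ℝ) ≤ 0 by rw [ht] at h1; linarith) t.2.1)
    subst ht0
    have : 2 * (secondHalf 0 : ℝ) = 1 := by rw [ht]; norm_num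
    rw [this, Set.projIcc_right]
    exact h
  · rw [h2, Set.projIcc_val]

theorem ext_halves {f g : C(I, B)} (h0 : beta0 f = beta0 g) (h1 : beta1 f = beta1 g) : f = g := by
  ext t
  rcases le_total (t : ℝ) (1 / 2) with ht | ht
  · have := DFunLike.congr_fun h0 ⟨2 * t, by constructor <;> linarith [t.2.1]⟩
    have e : firstHalf ⟨2 * t, by constructor <;> linarith [t.2.1]⟩ = t :=
      Subtype.ext (by simp [firstHalf])
    simpa only [beta0, ContinuousMap.comp_apply, e] using this
  · have := DFunLike.congr_fun h1 ⟨2 * t - 1, by constructor <;> linarith [t.2.2]⟩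
    have e : secondHalf ⟨2 * t - 1, by constructor <;> linarith [t.2.2]⟩ = t :=
      Subtype.ext (by simp [secondHalf])
    simpa only [beta1, ContinuousMap.comp_apply, e] using this

theorem nonneg_of_halves {f : C(I, B)} (h0 : 0 ≤ beta0 f) (h1 : 0 ≤ beta1 f) : 0 ≤ f := by
  intro t
  rcases le_total (t : ℝ) (1 / 2) with ht | ht
  · have := h0 ⟨2 * t, by constructor <;> linarith [t.2.1]⟩
    have e : firstHalf ⟨2 * t, by constructor <;> linarith [t.2.1]⟩ = t :=
      Subtype.ext (by simp [firstHalf])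
    have e' : beta0 f ⟨2 * t, by constructor <;> linarith [t.2.1]⟩ = f t := congrArg f e
    show 0 ≤ f t
    rw [← e']
    exact this
  · have := h1 ⟨2 * t - 1, by constructor <;> linarith [t.2.2]⟩
    have e : secondHalf ⟨2 * t - 1, by constructor <;> linarith [t.2.2]⟩ = t :=
      Subtype.ext (by simp [secondHalf])
    have e' : beta1 f ⟨2 * t - 1, by constructor <;> linarith [t.2.2]⟩ = f t := congrArg f e
    show 0 ≤ f t
    rw [← e']
    exact this

theorem norm_eq_halves (f : C(I, B)) : ‖f‖ = max ‖beta0 f‖ ‖beta1 f‖ := by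
  refine le_antisymm ?_ (max_le ?_ ?_)
  · refine (ContinuousMap.norm_le _ (le_max_of_le_left (norm_nonneg _))).2 fun t => ?_
    rcases le_total (t : ℝ) (1 / 2) with ht | ht
    · have e : firstHalf ⟨2 * t, by constructor <;> linarith [t.2.1]⟩ = t :=
        Subtype.ext (by simp [firstHalf])
      refine le_max_of_le_left ?_
      have := (beta0 f).norm_coe_le_norm ⟨2 * t, by constructor <;> linarith [t.2.1]⟩
      simpa only [beta0, ContinuousMap.comp_apply, e] using this
    · have e : secondHalf ⟨2 * t - 1, by constructor <;> linarith [t.2.2]⟩ = t :=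
        Subtype.ext (by simp [secondHalf])
      refine le_max_of_le_right ?_
      have := (beta1 f).norm_coe_le_norm ⟨2 * t - 1, by constructor <;> linarith [t.2.2]⟩
      simpa only [beta1, ContinuousMap.comp_apply, e] using this
  · exact (ContinuousMap.norm_le _ (norm_nonneg _)).2 fun t => f.norm_coe_le_norm _
  · exact (ContinuousMap.norm_le _ (norm_nonneg _)).2 fun t => f.norm_coe_le_norm _

variable [StarOrderedRing B] {X : GradedCorrespondence.{u, v, w} A C(I, B)}
  {X' : GradedCorrespondence.{u, v, w'} A C(I, B)} (U : EvenUnitary (X.fibre 1) (X'.fibre 0))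

/-- The underlying vector space `{(ξ, ξ') | U (ξ ⊗ 1) = ξ' ⊗ 1}` of `X ×_U X'`. -/
def glueSpace : Submodule ℂ (X × X') where
  carrier := {p | U.toEquiv (X.toFibre 1 p.1) = X'.toFibre 0 p.2}
  zero_mem' := by simp
  add_mem' {p q} hp hq := by
    have hp : U.toEquiv (X.toFibre 1 p.1) = X'.toFibre 0 p.2 := hp
    have hq : U.toEquiv (X.toFibre 1 q.1) = X'.toFibre 0 q.2 := hq
    show U.toEquiv (X.toFibre 1 (p.1 + q.1)) = X'.toFibre 0 (p.2 + q.2)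
    rw [map_add, map_add, map_add, hp, hq]
  smul_mem' c p hp := by
    have hp : U.toEquiv (X.toFibre 1 p.1) = X'.toFibre 0 p.2 := hp
    show U.toEquiv (X.toFibre 1 (c • p.1)) = X'.toFibre 0 (c • p.2)
    rw [map_smul, map_smul, map_smul, hp]

variable {U}

theorem glue_eq (p : glueSpace U) : U.toEquiv (X.toFibre 1 p.1.1) = X'.toFibre 0 p.1.2 := p.2

theorem ip_glue (p q : glueSpace U) :
    ip C(I, B) p.1.1 q.1.1 1 = ip C(I, B) p.1.2 q.1.2 0 := by
  rw [← ip_toFibre, ← ip_toFibre, ← glue_eq, ← glue_eq, U.map_ip]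

variable (U)

/-- The right action `(ξ, ξ') f = (ξ β₀(f), ξ' β₁(f))`. -/
instance glueSMul : SMul C(I, B)ᵐᵒᵖ (glueSpace U) where
  smul f p := ⟨(op (beta0 (unop f)) • p.1.1, op (beta1 (unop f)) • p.1.2), by
    show U.toEquiv (X.toFibre 1 (op (beta0 (unop f)) • p.1.1)) =
      X'.toFibre 0 (op (beta1 (unop f)) • p.1.2)
    have e : beta0 (unop f) 1 = beta1 (unop f) 0 :=
      congrArg (fun s => (unop f : C(I, B)) s) half_eq
    rw [toFibre_mul, toFibre_mul, U.map_mul, glue_eq, e]⟩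

/-- The inner product `⟪(ξ, ξ'), (η, η')⟫(t) = ⟪ξ, η⟫(2t)` for `t ≤ 1/2` and
`⟪ξ', η'⟫(2t - 1)` for `t ≥ 1/2`. -/
instance glueInner : Inner C(I, B)ᵐᵒᵖ (glueSpace U) where
  inner p q := op (concat (ip C(I, B) p.1.1 q.1.1) (ip C(I, B) p.1.2 q.1.2) (ip_glue p q))

theorem beta0_inner (p q : glueSpace U) :
    beta0 (unop (inner C(I, B)ᵐᵒᵖ p q)) = ip C(I, B) p.1.1 q.1.1 := beta0_concat _ _ (ip_glue p q)

theorem beta1_inner (p q : glueSpace U) :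
    beta1 (unop (inner C(I, B)ᵐᵒᵖ p q)) = ip C(I, B) p.1.2 q.1.2 := beta1_concat _ _ (ip_glue p q)

theorem beta0_mul (f g : C(I, B)) : beta0 (f * g) = beta0 f * beta0 g := rfl
theorem beta1_mul (f g : C(I, B)) : beta1 (f * g) = beta1 f * beta1 g := rfl
theorem beta0_add (f g : C(I, B)) : beta0 (f + g) = beta0 f + beta0 g := rfl
theorem beta1_add (f g : C(I, B)) : beta1 (f + g) = beta1 f + beta1 g := rfl
theorem beta0_star (f : C(I, B)) : beta0 (star f) = star (beta0 f) := rfl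
theorem beta1_star (f : C(I, B)) : beta1 (star f) = star (beta1 f) := rfl
theorem beta0_smul (c : ℂ) (f : C(I, B)) : beta0 (c • f) = c • beta0 f := rfl
theorem beta1_smul (c : ℂ) (f : C(I, B)) : beta1 (c • f) = c • beta1 f := rfl

theorem inner_ext {a b : C(I, B)ᵐᵒᵖ} (h0 : beta0 (unop a) = beta0 (unop b))
    (h1 : beta1 (unop a) = beta1 (unop b)) : a = b := unop_injective (ext_halves h0 h1)

instance glueCStarModule : CStarModule C(I, B)ᵐᵒᵖ (glueSpace U) where
  inner_add_right {p q r} := by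
    apply inner_ext
    · rw [unop_add, beta0_add, beta0_inner, beta0_inner, beta0_inner]
      exact ip_add_right _ _ _
    · rw [unop_add, beta1_add, beta1_inner, beta1_inner, beta1_inner]
      exact ip_add_right _ _ _
  inner_self_nonneg {p} :=
    nonneg_of_halves (by rw [beta0_inner]; exact ip_self_nonneg _)
      (by rw [beta1_inner]; exact ip_self_nonneg _)
  inner_self {p} := by
    constructor
    · intro h
      have h0 := beta0_inner U p p
      have h1 := beta1_inner U p p
      rw [h] at h0 h1
      exact Subtype.ext (Prod.ext (ip_self_eq_zero.1 h0.symm) (ip_self_eq_zero.1 h1.symm))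
    · rintro rfl
      apply inner_ext
      · rw [beta0_inner]; exact ip_zero_right _
      · rw [beta1_inner]; exact ip_zero_right _
  inner_op_smul_right {f p q} := by
    apply inner_ext
    · rw [unop_mul, beta0_mul, beta0_inner, beta0_inner]
      exact ip_mul_right p.1.1 q.1.1 (beta0 (unop f))
    · rw [unop_mul, beta1_mul, beta1_inner, beta1_inner]
      exact ip_mul_right p.1.2 q.1.2 (beta1 (unop f))
  inner_smul_right_complex {c p q} := by
    apply inner_ext
    · rw [unop_smul, beta0_smul, beta0_inner, beta0_inner]
      exact ip_smul_right _ _ _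
    · rw [unop_smul, beta1_smul, beta1_inner, beta1_inner]
      exact ip_smul_right _ _ _
  star_inner p q := by
    apply inner_ext
    · rw [unop_star, beta0_star, beta0_inner, beta0_inner, star_ip]
    · rw [unop_star, beta1_star, beta1_inner, beta1_inner, star_ip]
  norm_eq_sqrt_norm_inner_self p := by
    have h : ‖inner C(I, B)ᵐᵒᵖ p p‖ = max (‖p.1.1‖ ^ 2) (‖p.1.2‖ ^ 2) := by
      rw [norm_sq_eq_ip (B := C(I, B)), norm_sq_eq_ip (B := C(I, B)), ← beta0_inner U,
        ← beta1_inner U, ← norm_eq_halves, norm_unop]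
    have h2 : ‖p‖ = max ‖p.1.1‖ ‖p.1.2‖ := rfl
    rw [h, h2]
    rcases le_total ‖p.1.1‖ ‖p.1.2‖ with hle | hle
    · rw [max_eq_right hle, max_eq_right (by gcongr), Real.sqrt_sq (norm_nonneg _)]
    · rw [max_eq_left hle, max_eq_left (by gcongr), Real.sqrt_sq (norm_nonneg _)]

/-- The left action `a (ξ, ξ') = (a ξ, a ξ')`. -/
def glueLeft : A →ₙₐ[ℂ] Module.End ℂ (glueSpace U) where
  toFun a :=
    { toFun := fun p => ⟨(X.left a p.1.1, X'.left a p.1.2), by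
        show U.toEquiv (X.toFibre 1 (X.left a p.1.1)) = X'.toFibre 0 (X'.left a p.1.2)
        rw [← left_toFibre, ← left_toFibre, U.map_left, glue_eq]⟩
      map_add' := fun p q => by ext <;> simp
      map_smul' := fun c p => by ext <;> simp }
  map_smul' c a := by ext <;> simp
  map_zero' := by ext <;> simp
  map_add' a b := by ext <;> simp
  map_mul' a b := by ext <;> simp

/-- The grading operator `(ξ, ξ') ↦ (γ ξ, γ ξ')`. -/
def glueGrading : glueSpace U →ₗ[ℂ] glueSpace U where
  toFun p := ⟨(X.grading p.1.1, X'.grading p.1.2), by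
    show U.toEquiv (X.toFibre 1 (X.grading p.1.1)) = X'.toFibre 0 (X'.grading p.1.2)
    rw [← grading_toFibre, ← grading_toFibre, U.map_grading, glue_eq]⟩
  map_add' p q := by ext <;> simp
  map_smul' c p := by ext <;> simp

/-- The glued correspondence `X ×_U X'` from `A` to `C([0,1], B)`. -/
def glue : GradedCorrespondence.{u, v, max w w'} A C(I, B) where
  carrier := glueSpace U
  completeSpace := by
    have : IsClosed (glueSpace U : Set (X × X')) := by
      have hU : Continuous U.toEquiv :=
        AddMonoidHomClass.continuous_of_bound U.toEquiv 1 fun x => le_of_eq (by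
          rw [one_mul]
          refine (sq_eq_sq₀ (norm_nonneg _) (norm_nonneg _)).1 ?_
          rw [norm_sq_eq_ip (B := B), norm_sq_eq_ip (B := B), U.map_ip])
      exact isClosed_eq (hU.comp ((continuous_toFibre 1).comp continuous_fst))
        ((continuous_toFibre 0).comp continuous_snd)
    exact this.completeSpace_coe
  left := glueLeft U
  ip_left a p q := by
    apply ext_halves
    · exact (beta0_inner U _ _).trans ((X.ip_left a _ _).trans
        (beta0_inner U p (glueLeft U (star a) q)).symm)
    · exact (beta1_inner U _ _).trans ((X'.ip_left a _ _).trans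
        (beta1_inner U p (glueLeft U (star a) q)).symm)
  grading := glueGrading U
  grading_grading p := Subtype.ext (Prod.ext (X.grading_grading _) (X'.grading_grading _))
  grading_left a p := Subtype.ext (Prod.ext (X.grading_left a _) (X'.grading_left a _))
  grading_mul f p := Subtype.ext (Prod.ext (X.grading_mul (beta0 f) p.1.1)
    (X'.grading_mul (beta1 f) p.1.2))
  ip_grading p q := by
    apply ext_halves
    · refine (beta0_inner U _ _).trans ((X.ip_grading _ _).trans ?_)
      exact congrArg GradedCStarAlgebra.grading (beta0_inner U p q).symm
    · refine (beta1_inner U _ _).trans ((X'.ip_grading _ _).trans ?_)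
      exact congrArg GradedCStarAlgebra.grading (beta1_inner U p q).symm

/-- The element `(ξ, ξ')` of `X ⊕ X'` underlying an element of `X ×_U X'`. -/
def glueVal (p : glue U) : X × X' :=
  (show glueSpace U from p : X × X')

end Glue

end GradedCorrespondence

end

/-! Projection to the first coordinate maps `X ×_U X'` onto `X`, with kernel the vectors `(0, ξ')`
for which `ξ'` vanishes at `0`. Both claims are lifting arguments along this extension: approximate
in `X`, lift, and correct the error by something in the kernel. The lift is controlled because `U`
is isometric: if `(ξ, ξ')` has small `ξ`, then `ξ'` is small in the fibre at `0`
(`norm_toFibre_glue`), though possibly large elsewhere.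

Countable generation: the generators are lifts of generators of `X`, together with the vectors `(0,
s φₖ g)`, where `s` generates `X'`, `φₖ` is a scalar cutoff vanishing at `0`, and `g` runs through
countably many coefficients with `s g → s`. A vector `ζ` of `X'` with norm at most `r` at `0` is
within `r` of some `ζ g` with `g 0 = 0` (`exists_approx`), and such vectors are reached by the
second kind of generators.

Compactness: approximate `K` by a finite sum `F` of rank one operators and lift its vectors, which
gives a finite rank operator on the gluing acting as some `F'` on `X'`. The remainder `D = K' - F'`
is compact and small in the fibre at `0`. It must be approximated by finite rank operators vanishing
at `0`, since these extend by zero to the gluing. Multiplying by `φₖ` does this provided `D` is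
small near `0` and not only at `0`. This is upper semicontinuity of the fibre norm, proved for
finite rank operators in `FibreBound.eventually_finiteRank`: by the C*-identity the norm of `S` is
governed by high powers of `S* S`, and these are sums `∑ T xᵢ ⟪yᵢ, ·⟫` with a bound that is
continuous in `t` and loses only a constant factor, which a large root makes negligible. -/

section HilbertModule

/-! ### Adjoint pairs and finite sums of rank one operators -/

variable {B : Type v} [NonUnitalCStarAlgebra B] [PartialOrder B] [StarOrderedRing B]
  {E : Type w} [NormedAddCommGroup E] [NormedSpace ℂ E] [SMul Bᵐᵒᵖ E] [CStarModule Bᵐᵒᵖ E]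

theorem rankOne_apply (x y z : E) : rankOne B x y z = op (ip B y z) • x := rfl

theorem op_smul_sub (b : B) (x y : E) : op b • (x - y) = op b • x - op b • y :=
  map_sub (rmul E b) x y

theorem op_smul_smul (b : B) (c : ℂ) (x : E) : op b • (c • x) = c • (op b • x) :=
  map_smul (rmul E b) c x

/-- The right action is a bare `SMul`; the module laws follow from nondegeneracy of the inner
product. -/
theorem sub_op_smul (b c : B) (x : E) : op (b - c) • x = op b • x - op c • x :=
  ip_ext (B := B) fun z => by simp only [ip_mul_right, ip_sub_right, mul_sub]

theorem op_mul_smul (b c : B) (x : E) : op (b * c) • x = op c • op b • x :=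
  ip_ext (B := B) fun z => by simp only [ip_mul_right, mul_assoc]

theorem op_smul_left_smul (b : B) (c : ℂ) (x : E) : op (c • b) • x = c • (op b • x) :=
  ip_ext (B := B) fun z => by simp only [ip_mul_right, ip_smul_right, mul_smul_comm]

theorem norm_rankOne_le (x y : E) : ‖rankOne B x y‖ ≤ ‖x‖ * ‖y‖ :=
  LinearMap.mkContinuous_norm_le _ (by positivity) _

theorem smul_rankOne (c : ℂ) (x y : E) : c • rankOne B x y = rankOne B (c • x) y := by
  ext z
  exact (op_smul_smul _ c x).symm

theorem rankOne_sub_left (x x' y : E) :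
    rankOne B x y - rankOne B x' y = rankOne B (x - x') y := by
  ext z
  exact (op_smul_sub _ x x').symm

variable (B) in
/-- The operator `S` is an adjoint of `T`. -/
def IsAdjointPairOn (T S : E →L[ℂ] E) : Prop := ∀ x y, ip B (T x) y = ip B x (S y)

namespace IsAdjointPairOn

variable {T T' S S' : E →L[ℂ] E}

theorem symm (h : IsAdjointPairOn B T S) : IsAdjointPairOn B S T := fun x y => by
  rw [← star_ip, ← h, star_ip]

theorem sub (h : IsAdjointPairOn B T S) (h' : IsAdjointPairOn B T' S') :
    IsAdjointPairOn B (T - T') (S - S') := fun x y => by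
  rw [sub_apply, sub_apply, ip_sub_left, ip_sub_right,
    h, h']

theorem comp (h : IsAdjointPairOn B T S) (h' : IsAdjointPairOn B T' S') :
    IsAdjointPairOn B (T * T') (S' * S) := fun _ _ => (h _ _).trans (h' _ _)

theorem pow (h : IsAdjointPairOn B T T) (n : ℕ) : IsAdjointPairOn B (T ^ n) (T ^ n) := by
  induction n with
  | zero => exact fun x y => rfl
  | succ n ih =>
    have := ih.comp h
    rwa [← pow_succ, ← pow_succ'] at this

theorem rankOne (x y : E) : IsAdjointPairOn B (rankOne B x y) (rankOne B y x) := fun z w => by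
  rw [rankOne_apply, rankOne_apply, ip_mul_left, ip_mul_right, star_ip]

theorem sum {ι : Type*} (s : Finset ι) {f g : ι → E →L[ℂ] E}
    (h : ∀ i, IsAdjointPairOn B (f i) (g i)) :
    IsAdjointPairOn B (∑ i ∈ s, f i) (∑ i ∈ s, g i) := by
  classical
  induction s using Finset.induction_on with
  | empty =>
    intro x y
    rw [Finset.sum_empty, Finset.sum_empty, zero_apply, zero_apply, ip_zero_right, ← star_ip, ip_zero_right, star_zero]
  | insert i s hi ih =>
    intro x y
    rw [Finset.sum_insert hi, Finset.sum_insert hi, add_apply, add_apply, ip_add_left, ip_add_right, h, ih]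

theorem map_mul (h : IsAdjointPairOn B T S) (b : B) (x : E) : T (op b • x) = op b • T x :=
  ip_ext (B := B) fun z => by rw [← h.symm, ip_mul_right, ip_mul_right, ← h.symm]

end IsAdjointPairOn

variable (B) in
/-- The operator `∑ᵢ xᵢ ⟪yᵢ, ·⟫`. -/
def finiteRank {n : ℕ} (x y : Fin n → E) : E →L[ℂ] E := ∑ i, rankOne B (x i) (y i)

theorem finiteRank_apply {n : ℕ} (x y : Fin n → E) (z : E) :
    finiteRank B x y z = ∑ i, op (ip B (y i) z) • x i := by
  rw [finiteRank, sum_apply]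
  rfl

theorem isAdjointPairOn_finiteRank {n : ℕ} (x y : Fin n → E) :
    IsAdjointPairOn B (finiteRank B x y) (finiteRank B y x) :=
  IsAdjointPairOn.sum _ fun _ => IsAdjointPairOn.rankOne _ _

/-- Adjointable operators are right linear, so `T` passes through the coefficients. In particular a
power of `S* S` keeps the vectors `y` and the number of terms of `S`. -/
theorem comp_finiteRank {n : ℕ} {T S : E →L[ℂ] E} (h : IsAdjointPairOn B T S) (x y : Fin n → E) :
    T * finiteRank B x y = finiteRank B (fun i => T (x i)) y := by
  ext z
  rw [mul_apply_eq_comp, finiteRank_apply, finiteRank_apply, map_sum]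
  exact Finset.sum_congr rfl fun i _ => h.map_mul _ _

theorem finiteRank_mem_span {n : ℕ} (x y : Fin n → E) :
    finiteRank B x y ∈ Submodule.span ℂ {R : E →L[ℂ] E | ∃ x y : E, R = rankOne B x y} :=
  Submodule.sum_mem _ fun i _ => Submodule.subset_span ⟨x i, y i, rfl⟩

theorem exists_finiteRank_eq {T : E →L[ℂ] E}
    (hT : T ∈ Submodule.span ℂ {R : E →L[ℂ] E | ∃ x y : E, R = rankOne B x y}) :
    ∃ (n : ℕ) (x y : Fin n → E), T = finiteRank B x y := by
  obtain ⟨n, c, g, rfl⟩ := Submodule.mem_span_set'.1 hT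
  choose x y hxy using fun i => (g i).2
  refine ⟨n, fun i => c i • x i, y, Finset.sum_congr rfl fun i _ => ?_⟩
  rw [hxy, smul_rankOne]

/-- Operators in the closure of the span of the rank one operators are approximated by finite sums
of operators `x g ⟪y, ·⟫`. -/
theorem exists_finiteRank_norm_sub_lt {T : E →L[ℂ] E}
    (hT : T ∈ closure
      (Submodule.span ℂ {R : E →L[ℂ] E | ∃ x y : E, R = rankOne B x y} : Set (E →L[ℂ] E)))
    {ε : ℝ} (hε : 0 < ε) :
    ∃ (n : ℕ) (x y : Fin n → E) (g : Fin n → B),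
      ‖T - finiteRank B (fun i => op (g i) • x i) y‖ < ε := by
  obtain ⟨S, hS, hTS⟩ := Metric.mem_closure_iff.1 hT (ε / 2) (by positivity)
  obtain ⟨n, x, y, rfl⟩ := exists_finiteRank_eq hS
  -- The summands `+ 1` keep the denominators positive when `n = 0` or `y i = 0`; the `n` errors
  -- still add up to at most `ε / 2`.
  have key : ∀ i, ∃ g : B, ‖x i - op g • x i‖ * ‖y i‖ ≤ ε / 2 / (n + 1) := fun i => by
    obtain ⟨g, hg, -⟩ := exists_approx (B := B) (x i)
      (r := (ε / 2 / (n + 1) / (‖y i‖ + 1)) ^ 2) (by positivity)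
    refine ⟨g, ?_⟩
    have h1 : ‖x i - op g • x i‖ ≤ ε / 2 / (n + 1) / (‖y i‖ + 1) :=
      le_of_sq_le_sq hg (by positivity)
    calc _ ≤ ε / 2 / (n + 1) / (‖y i‖ + 1) * (‖y i‖ + 1) := by gcongr; linarith
      _ = _ := div_mul_cancel₀ _ (by positivity)
  choose g hg using key
  refine ⟨n, x, y, g, ?_⟩
  have h2 : finiteRank B x y - finiteRank B (fun i => op (g i) • x i) y =
      ∑ i, rankOne B (x i - op (g i) • x i) (y i) := by
    rw [finiteRank, finiteRank, ← Finset.sum_sub_distrib]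
    exact Finset.sum_congr rfl fun i _ => rankOne_sub_left _ _ _
  have h3 : ‖finiteRank B x y - finiteRank B (fun i => op (g i) • x i) y‖ ≤ ε / 2 := by
    rw [h2]
    calc _ ≤ ∑ _i : Fin n, ε / 2 / (n + 1) :=
          (norm_sum_le _ _).trans (Finset.sum_le_sum fun i _ => (norm_rankOne_le _ _).trans (hg i))
      _ = n * (ε / 2 / (n + 1)) := by simp
      _ ≤ (n + 1) * (ε / 2 / (n + 1)) := by gcongr; linarith
      _ = ε / 2 := mul_div_cancel₀ _ (by positivity)
  rw [dist_eq_norm] at hTS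
  calc _ = ‖(T - finiteRank B x y) +
        (finiteRank B x y - finiteRank B (fun i => op (g i) • x i) y)‖ := by rw [sub_add_sub_cancel]
    _ < ε / 2 + ε / 2 := (norm_add_le _ _).trans_lt (by linarith)
    _ = ε := by ring

end HilbertModule

namespace GradedCorrespondence

variable {A : Type u} {B : Type v} [NonUnitalCStarAlgebra A] [GradedCStarAlgebra A]
  [NonUnitalCStarAlgebra B] [PartialOrder B] [GradedCStarAlgebra B] [StarOrderedRing B]

/-! ### Operator bounds on fibres and their upper semicontinuity -/

section FibreBound

variable {X : GradedCorrespondence.{u, v, w} A C(I, B)} {t : I}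

theorem norm_toFibre (t : I) (ξ : X) : ‖X.toFibre t ξ‖ = √‖ip C(I, B) ξ ξ t‖ := X.norm_mk_eq t ξ

theorem norm_toFibre_sq (t : I) (ξ : X) : ‖X.toFibre t ξ‖ ^ 2 = ‖ip C(I, B) ξ ξ t‖ := by
  rw [norm_toFibre, Real.sq_sqrt (norm_nonneg _)]

theorem norm_toFibre_le (t : I) (ξ : X) : ‖X.toFibre t ξ‖ ≤ ‖ξ‖ :=
  Submodule.Quotient.norm_mk_le _ ξ

theorem norm_ip_apply_le (t : I) (ξ η : X) :
    ‖ip C(I, B) ξ η t‖ ≤ ‖X.toFibre t ξ‖ * ‖X.toFibre t η‖ := by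
  rw [← ip_toFibre]
  exact norm_ip_le _ _

theorem continuous_norm_toFibre (ξ : X) : Continuous fun t => ‖X.toFibre t ξ‖ := by
  simp only [norm_toFibre]
  exact (ip C(I, B) ξ ξ).continuous.norm.sqrt

/-- The norm of `C(I, B)` is a supremum over points, so the norm of `X` is the supremum of the fibre
norms. -/
theorem norm_le_of_norm_toFibre_le {ξ : X} {c : ℝ} (hc : 0 ≤ c)
    (h : ∀ t, ‖X.toFibre t ξ‖ ≤ c) : ‖ξ‖ ≤ c := by
  refine le_of_sq_le_sq ?_ hc
  rw [norm_sq_eq_ip (B := C(I, B))]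
  refine (ContinuousMap.norm_le _ (by positivity)).2 fun t => ?_
  rw [← norm_toFibre_sq]
  exact pow_le_pow_left₀ (norm_nonneg _) (h t) 2

theorem toFibre_eq_zero_iff {ξ : X} : X.toFibre t ξ = 0 ↔ ip C(I, B) ξ ξ t = 0 :=
  Submodule.Quotient.mk_eq_zero (X.vanishing t)

/-- The operator `T` induces on the fibre at `t` an operator of norm at most `r`. -/
def FibreBound (t : I) (T : X →L[ℂ] X) (r : ℝ) : Prop :=
  ∀ ξ, ‖X.toFibre t (T ξ)‖ ≤ r * ‖X.toFibre t ξ‖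

namespace FibreBound

variable {T S : X →L[ℂ] X} {r s : ℝ}

theorem of_isAdjointPairOn (h : IsAdjointPairOn C(I, B) T S) : FibreBound t T ‖T‖ := fun ξ =>
  (fibreMap t T (adjointable_mem_vanishing t h).1).le_of_opNorm_le
    (LinearMap.mkContinuous_norm_le _ (norm_nonneg _) _) (X.toFibre t ξ)

theorem mono (h : FibreBound t T r) (hrs : r ≤ s) : FibreBound t T s := fun ξ =>
  (h ξ).trans (by gcongr)

theorem add (h : FibreBound t T r) (h' : FibreBound t S s) : FibreBound t (T + S) (r + s) :=
  fun ξ => by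
    rw [add_apply, map_add, add_mul]
    exact (norm_add_le _ _).trans (add_le_add (h ξ) (h' ξ))

theorem mul (h : FibreBound t T r) (h' : FibreBound t S s) (hr : 0 ≤ r) :
    FibreBound t (T * S) (r * s) := fun ξ =>
  (h _).trans (by rw [mul_assoc]; exact mul_le_mul_of_nonneg_left (h' ξ) hr)

theorem pow (h : FibreBound t T r) (hr : 0 ≤ r) (n : ℕ) : FibreBound t (T ^ n) (r ^ n) := by
  induction n with
  | zero => exact fun ξ => by simp
  | succ n ih => rw [pow_succ, pow_succ]; exact ih.mul h (pow_nonneg hr n)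

/-- Cauchy–Schwarz in the fibre gives `‖Sξ‖² ≤ ‖TSξ‖ ‖ξ‖ ≤ r ‖Sξ‖ ‖ξ‖`; divide by `‖Sξ‖` when it is
nonzero. -/
theorem adjoint (h : FibreBound t T r) (hTS : IsAdjointPairOn C(I, B) T S) (hr : 0 ≤ r) :
    FibreBound t S r := fun ξ => by
  rcases (norm_nonneg (X.toFibre t (S ξ))).eq_or_lt with h0 | h0
  · rw [← h0]; positivity
  · refine le_of_mul_le_mul_left ?_ h0
    calc _ = ‖X.toFibre t (S ξ)‖ ^ 2 := (sq _).symm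
      _ = ‖ip C(I, B) (T (S ξ)) ξ t‖ := by rw [norm_toFibre_sq, hTS]
      _ ≤ ‖X.toFibre t (T (S ξ))‖ * ‖X.toFibre t ξ‖ := norm_ip_apply_le _ _ _
      _ ≤ r * ‖X.toFibre t (S ξ)‖ * ‖X.toFibre t ξ‖ := by gcongr; exact h _
      _ = _ := by ring

/-- The `C*`-identity on the fibre. -/
theorem of_adjoint_mul_self (hTS : IsAdjointPairOn C(I, B) T S) (hr : 0 ≤ r)
    (h : FibreBound t (S * T) (r ^ 2)) : FibreBound t T r := fun ξ => by
  refine le_of_sq_le_sq ?_ (by positivity)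
  calc _ = ‖ip C(I, B) ξ (S (T ξ)) t‖ := by rw [norm_toFibre_sq, hTS]
    _ ≤ ‖X.toFibre t ξ‖ * ‖X.toFibre t (S (T ξ))‖ := norm_ip_apply_le _ _ _
    _ ≤ ‖X.toFibre t ξ‖ * (r ^ 2 * ‖X.toFibre t ξ‖) := by gcongr; exact h _
    _ = _ := by ring

/-- Each power `T ^ 2 ^ k` is self-adjoint, so the C*-identity extracts one square root per
induction step. -/
theorem of_pow (hT : IsAdjointPairOn C(I, B) T T) (hr : 0 ≤ r) (k : ℕ)
    (h : FibreBound t (T ^ 2 ^ k) (r ^ 2 ^ k)) : FibreBound t T r := by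
  induction k with
  | zero => simpa using h
  | succ k ih =>
    refine ih (of_adjoint_mul_self (hT.pow _) (pow_nonneg hr _) ?_)
    rwa [← pow_add, ← pow_mul, ← mul_two, ← pow_succ]

/-- A crude bound, but it involves only finitely many vectors and is therefore continuous in `t`.
Localising the `x i` alone is enough. -/
theorem finiteRank {n : ℕ} (t : I) (x y : Fin n → X) :
    FibreBound t (finiteRank C(I, B) x y) (∑ i, ‖X.toFibre t (x i)‖ * ‖y i‖) := fun ξ => by
  rw [finiteRank_apply, map_sum, Finset.sum_mul]
  refine (norm_sum_le _ _).trans (Finset.sum_le_sum fun i _ => ?_)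
  rw [toFibre_mul]
  refine (norm_op_smul_le _ _).trans ?_
  rw [mul_assoc]
  gcongr
  refine (norm_ip_apply_le _ _ _).trans ?_
  gcongr
  exact norm_toFibre_le _ _

/-- The norm on the fibres of a finite sum of rank one operators is upper semicontinuous. -/
theorem eventually_finiteRank {n : ℕ} {x y : Fin n → X} (hr : 0 < r) (hrs : r < s)
    (h : FibreBound t (_root_.finiteRank C(I, B) x y) r) :
    ∀ᶠ t' in 𝓝 t, FibreBound t' (_root_.finiteRank C(I, B) x y) s := by
  set S := _root_.finiteRank C(I, B) x y with hS
  set S' := _root_.finiteRank C(I, B) y x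
  have hs : 0 < s := hr.trans hrs
  have hadj : IsAdjointPairOn C(I, B) S S' := isAdjointPairOn_finiteRank x y
  have hsa : IsAdjointPairOn C(I, B) (S' * S) (S' * S) := hadj.symm.comp hadj
  have h' : FibreBound t S' r := h.adjoint hadj hr.le
  have hb : FibreBound t (S' * S) (r ^ 2) := by rw [sq]; exact h'.mul h hr.le
  -- The left side bounds `(S* S) ^ 2 ^ k` at `t`. It is `(r²) ^ 2 ^ k` up to a factor independent
  -- of `k`, so it falls below `(s²) ^ 2 ^ k` because `r < s`.
  obtain ⟨k, hk⟩ : ∃ k : ℕ,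
      (r ^ 2) ^ (2 ^ k - 1) * r * ∑ i, ‖x i‖ * ‖y i‖ < (s ^ 2) ^ 2 ^ k := by
    set D := ∑ i, ‖x i‖ * ‖y i‖
    have hD : 0 ≤ D := Finset.sum_nonneg fun i _ => by positivity
    obtain ⟨k, hk⟩ := exists_pow_lt_of_lt_one (x := r / (D + 1)) (y := r ^ 2 / s ^ 2)
      (by positivity) ((div_lt_one (by positivity)).2 (by gcongr))
    have hk' : (r ^ 2 / s ^ 2) ^ 2 ^ k < r / (D + 1) :=
      (pow_le_pow_of_le_one (by positivity)
        ((div_le_one (by positivity)).2 (by gcongr)) Nat.lt_two_pow_self.le).trans_lt hk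
    refine ⟨k, ?_⟩
    rw [div_pow, div_lt_div_iff₀ (by positivity) (by positivity)] at hk'
    have e : (r ^ 2) ^ 2 ^ k = (r ^ 2) ^ (2 ^ k - 1) * r * r := by
      conv_lhs => rw [← Nat.sub_add_cancel (Nat.one_le_two_pow (n := k)), pow_succ]
      ring
    rw [e] at hk'
    refine lt_of_mul_lt_mul_left ?_ hr.le
    refine lt_of_le_of_lt ?_ hk'
    have : 0 ≤ (r ^ 2) ^ (2 ^ k - 1) * r * r := by positivity
    nlinarith
  set T := (S' * S) ^ (2 ^ k - 1) * S' with hT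
  -- One factor `S` is split off on the right and the others, gathered in `T`, act on its vectors `x
  -- i`.
  have hpow : (S' * S) ^ 2 ^ k = _root_.finiteRank C(I, B) (fun i => T (x i)) y := by
    rw [← comp_finiteRank ((hsa.pow _).comp hadj.symm), ← hS, mul_assoc, ← pow_succ,
      Nat.sub_add_cancel Nat.one_le_two_pow]
  have hc : Continuous fun t' => ∑ i, ‖X.toFibre t' (T (x i))‖ * ‖y i‖ :=
    continuous_finsetSum _ fun i _ => (continuous_norm_toFibre _).mul continuous_const
  have hlt : ∑ i, ‖X.toFibre t (T (x i))‖ * ‖y i‖ < (s ^ 2) ^ 2 ^ k := by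
    refine lt_of_le_of_lt ?_ hk
    rw [Finset.mul_sum]
    refine Finset.sum_le_sum fun i _ => ?_
    rw [← mul_assoc]
    gcongr
    refine (((hb.pow (by positivity) _).mul h' (by positivity)) (x i)).trans ?_
    gcongr
    exact norm_toFibre_le _ _
  -- The strict inequality at `t` persists nearby by continuity; at such `t'` the bound is brought
  -- back from the power to `S* S`, then to `S`.
  filter_upwards [hc.continuousAt.eventually_lt continuousAt_const hlt] with t' ht'
  refine of_adjoint_mul_self hadj hs.le (of_pow hsa (by positivity) k ?_)
  rw [hpow]
  exact (FibreBound.finiteRank t' _ _).mono ht'.le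

end FibreBound

end FibreBound

/-! ### Cutting off near the gluing point -/

section Cutoff

/-- The function `t ↦ min (k t) 1`. -/
def cutoff (k : ℕ) : C(I, ℂ) where
  toFun t := ((min (k * t : ℝ) 1 : ℝ) : ℂ)
  continuous_toFun := by fun_prop

theorem cutoff_zero (k : ℕ) : cutoff k 0 = 0 := by simp [cutoff]

theorem norm_one_sub_cutoff_le (k : ℕ) (t : I) : ‖1 - cutoff k t‖ ≤ 1 := by
  have h0 : 0 ≤ min (k * t : ℝ) 1 := le_min (mul_nonneg k.cast_nonneg t.2.1) zero_le_one
  have h1 : min (k * t : ℝ) 1 ≤ 1 := min_le_right _ _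
  have e : 1 - cutoff k t = ((1 - min (k * t : ℝ) 1 : ℝ) : ℂ) := by
    rw [Complex.ofReal_sub, Complex.ofReal_one]; rfl
  rw [e, Complex.norm_real, Real.norm_of_nonneg (by linarith)]
  linarith

theorem exists_cutoff_eq_one {V : Set I} (hV : V ∈ 𝓝 (0 : I)) :
    ∃ k, ∀ t ∉ V, cutoff k t = 1 := by
  obtain ⟨δ, hδ, hball⟩ := Metric.mem_nhds_iff.1 hV
  obtain ⟨k, hk⟩ := exists_nat_gt (1 / δ)
  refine ⟨k, fun t ht => ?_⟩
  have h1 : δ ≤ (t : ℝ) := by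
    by_contra hlt
    refine ht (hball ?_)
    rw [Metric.mem_ball, Subtype.dist_eq, Real.dist_eq, Set.Icc.coe_zero, sub_zero,
      abs_of_nonneg t.2.1]
    exact not_le.1 hlt
  have h2 : 1 ≤ (k * t : ℝ) := by
    rw [div_lt_iff₀ hδ] at hk
    exact hk.le.trans (by gcongr)
  show ((min (k * t : ℝ) 1 : ℝ) : ℂ) = 1
  rw [min_eq_right h2, Complex.ofReal_one]

theorem cutoff_smul_apply_zero (k : ℕ) (g : C(I, B)) : (cutoff k • g) 0 = 0 := by
  show cutoff k 0 • g 0 = 0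
  rw [cutoff_zero, zero_smul]

/-- Functions vanishing at `0` are approximated by their cutoffs. -/
theorem exists_norm_sub_cutoff_smul_le {g : C(I, B)} (hg : g 0 = 0) {ε : ℝ} (hε : 0 < ε) :
    ∃ k, ‖g - cutoff k • g‖ ≤ ε := by
  have hV : {t | ‖g t‖ < ε} ∈ 𝓝 (0 : I) :=
    g.continuous.norm.continuousAt.eventually_lt continuousAt_const (by simpa [hg] using hε)
  obtain ⟨k, hk⟩ := exists_cutoff_eq_one hV
  refine ⟨k, (ContinuousMap.norm_le _ hε.le).2 fun t => ?_⟩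
  have e : (g - cutoff k • g) t = (1 - cutoff k t) • g t := by
    rw [sub_smul, one_smul]; rfl
  rw [e, norm_smul]
  -- Where `g` is small the factor `1 - φₖ` has norm at most `1`; elsewhere it is zero.
  by_cases ht : ‖g t‖ < ε
  · calc _ ≤ 1 * ‖g t‖ := by gcongr; exact norm_one_sub_cutoff_le k t
      _ ≤ ε := by rw [one_mul]; exact ht.le
  · rw [hk t ht, sub_self, norm_zero, zero_mul]
    exact hε.le

variable {X : GradedCorrespondence.{u, v, w} A C(I, B)}

/-- If `∑ᵢ xᵢ gᵢ ⟪yᵢ, ·⟫` has norm less than `r` on the fibre at `0`, it is approximated up to `r`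
by an operator vanishing at `0`. -/
theorem exists_cutoff_finiteRank {n : ℕ} (x y : Fin n → X) (g : Fin n → C(I, B)) {r s : ℝ}
    (hr : 0 < r) (hrs : r < s)
    (h : FibreBound 0 (finiteRank C(I, B) (fun i => op (g i) • x i) y) r) :
    ∃ k, ‖finiteRank C(I, B) (fun i => op (g i) • x i) y -
      finiteRank C(I, B) (fun i => op (cutoff k • g i) • x i) y‖ ≤ s := by
  have hs : 0 < s := hr.trans hrs
  -- The cutoff equals `1` wherever the fibre bound `s` fails, so those fibres contribute nothing to
  -- the difference.
  obtain ⟨k, hk⟩ := exists_cutoff_eq_one (h.eventually_finiteRank hr hrs)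
  refine ⟨k, ContinuousLinearMap.opNorm_le_bound _ hs.le fun ξ => ?_⟩
  refine norm_le_of_norm_toFibre_le (by positivity) fun t => ?_
  have e : X.toFibre t ((finiteRank C(I, B) (fun i => op (g i) • x i) y -
      finiteRank C(I, B) (fun i => op (cutoff k • g i) • x i) y) ξ) =
      (1 - cutoff k t) • X.toFibre t (finiteRank C(I, B) (fun i => op (g i) • x i) y ξ) := by
    rw [sub_apply, map_sub, sub_smul, one_smul, finiteRank_apply,
      finiteRank_apply, map_sum, map_sum, Finset.smul_sum]
    congr 1
    refine Finset.sum_congr rfl fun i _ => ?_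
    rw [toFibre_mul, toFibre_mul, toFibre_mul, toFibre_mul, ← op_smul_smul, ← op_smul_left_smul]
    rfl
  rw [e, norm_smul]
  by_cases ht : FibreBound t (finiteRank C(I, B) (fun i => op (g i) • x i) y) s
  · calc _ ≤ 1 * (s * ‖X.toFibre t ξ‖) := by
          gcongr
          · exact norm_one_sub_cutoff_le k t
          · exact ht ξ
      _ ≤ s * ‖ξ‖ := by rw [one_mul]; gcongr; exact norm_toFibre_le _ _
  · rw [hk t ht, sub_self, norm_zero, zero_mul]
    positivity

/-- A compact operator of norm less than `δ` on the fibre at `0` is approximated up to `4 δ` by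
finite sums of rank one operators with cut off coefficients. -/
theorem exists_cutoff_norm_sub_le {D D' : X →L[ℂ] X} (hadj : IsAdjointPairOn C(I, B) D D')
    (hc : D ∈ closure
      (Submodule.span ℂ {R : X →L[ℂ] X | ∃ x y : X, R = rankOne C(I, B) x y} : Set (X →L[ℂ] X)))
    {δ : ℝ} (hδ : 0 < δ) (hD : FibreBound 0 D δ) :
    ∃ (n : ℕ) (x y : Fin n → X) (g : Fin n → C(I, B)) (k : ℕ),
      ‖D - finiteRank C(I, B) (fun i => op (cutoff k • g i) • x i) y‖ ≤ 4 * δ := by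
  obtain ⟨n, x, y, g, hS⟩ := exists_finiteRank_norm_sub_lt (B := C(I, B)) hc hδ
  -- One `δ` comes from `D` at `0`, the other from the norm distance between `D` and its finite rank
  -- approximation.
  have hSb : FibreBound 0 (finiteRank C(I, B) (fun i => op (g i) • x i) y) (2 * δ) := by
    have hadj' := (isAdjointPairOn_finiteRank (B := C(I, B)) (fun i => op (g i) • x i) y).sub hadj
    have h1 := hD.add ((FibreBound.of_isAdjointPairOn hadj').mono
      ((norm_sub_rev _ _).trans_le hS.le))
    rwa [add_sub_cancel, ← two_mul] at h1
  obtain ⟨k, hk⟩ := exists_cutoff_finiteRank x y g (s := 3 * δ) (by positivity) (by linarith) hSb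
  refine ⟨n, x, y, g, k, ?_⟩
  calc _ = ‖(D - finiteRank C(I, B) (fun i => op (g i) • x i) y) +
        (finiteRank C(I, B) (fun i => op (g i) • x i) y -
          finiteRank C(I, B) (fun i => op (cutoff k • g i) • x i) y)‖ := by rw [sub_add_sub_cancel]
    _ ≤ δ + 3 * δ := (norm_add_le _ _).trans (add_le_add hS.le hk)
    _ = 4 * δ := by ring

end Cutoff

/-! ### Lifting vectors to the gluing -/

section Glue

variable {X : GradedCorrespondence.{u, v, w} A C(I, B)}
  {X' : GradedCorrespondence.{u, v, w'} A C(I, B)} {U : EvenUnitary (X.fibre 1) (X'.fibre 0)}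

/-- A function on the first half extends by a constant. Hence acting on the gluing realises every
coefficient on `X`, and likewise on `X'`. -/
theorem beta0_surjective : Function.Surjective (beta0 : C(I, B) → C(I, B)) := fun f =>
  ⟨concat f (ContinuousMap.const I (f 1)) rfl, beta0_concat _ _ _⟩

theorem beta1_surjective : Function.Surjective (beta1 : C(I, B) → C(I, B)) := fun f =>
  ⟨concat (ContinuousMap.const I (f 0)) f rfl, beta1_concat _ _ _⟩

theorem exists_glue_fst (U : EvenUnitary (X.fibre 1) (X'.fibre 0)) (ξ : X) :
    ∃ p : glueSpace U, p.1.1 = ξ := by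
  obtain ⟨ξ', h⟩ := toFibre_surjective (X := X') 0 (U.toEquiv (X.toFibre 1 ξ))
  exact ⟨⟨(ξ, ξ'), h.symm⟩, rfl⟩

theorem exists_glue_snd (U : EvenUnitary (X.fibre 1) (X'.fibre 0)) (ξ' : X') :
    ∃ p : glueSpace U, p.1.2 = ξ' := by
  obtain ⟨ξ, h⟩ := toFibre_surjective (X := X) 1 (U.toEquiv.symm (X'.toFibre 0 ξ'))
  refine ⟨⟨(ξ, ξ'), ?_⟩, rfl⟩
  show U.toEquiv (X.toFibre 1 ξ) = X'.toFibre 0 ξ'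
  rw [h, LinearEquiv.apply_symm_apply]

theorem norm_glue (p : glueSpace U) : ‖p‖ = max ‖p.1.1‖ ‖p.1.2‖ := rfl

theorem norm_unitary (x : X.fibre 1) : ‖U.toEquiv x‖ = ‖x‖ :=
  (sq_eq_sq₀ (norm_nonneg _) (norm_nonneg _)).1 (by
    rw [norm_sq_eq_ip (B := B), norm_sq_eq_ip (B := B), U.map_ip])

/-- This transfers smallness from `X` to `X'`, at the point `0` only. -/
theorem norm_toFibre_glue (p : glueSpace U) :
    ‖X'.toFibre 0 p.1.2‖ = ‖X.toFibre 1 p.1.1‖ := by rw [← glue_eq, norm_unitary]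

/-- The element `(0, ξ')` of `X ×_U X'`, for `ξ'` vanishing at `0`. -/
def glueOfVanishing (U : EvenUnitary (X.fibre 1) (X'.fibre 0)) :
    X'.vanishing 0 →ₗ[ℂ] glueSpace U where
  toFun ξ := ⟨(0, ξ), by
    show U.toEquiv (X.toFibre 1 0) = X'.toFibre 0 ξ
    rw [map_zero, map_zero, toFibre_eq_zero_iff.2 ξ.2]⟩
  map_add' ξ η := Subtype.ext (Prod.ext (add_zero 0).symm rfl)
  map_smul' c ξ := Subtype.ext (Prod.ext (smul_zero c).symm rfl)

theorem norm_glueOfVanishing (ξ : X'.vanishing 0) : ‖glueOfVanishing U ξ‖ = ‖ξ‖ := by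
  rw [norm_glue]
  exact (congrArg (max · ‖ξ.1‖) norm_zero).trans (max_eq_right (norm_nonneg _))

theorem op_smul_mem_vanishing_of_apply_eq_zero {f : C(I, B)} (hf : f 0 = 0) (ξ : X') :
    op f • ξ ∈ X'.vanishing 0 := by
  rw [mem_vanishing, ip_mul_right, ContinuousMap.mul_apply, hf, mul_zero]

/-! ### Countable generation -/

section CountablyGenerated

/-- The element `(0, ξ' φₖ f)` of `X ×_U X'`, as a function of `ξ'`, where `φₖ` is a cutoff. -/
noncomputable def glueCutoff (U : EvenUnitary (X.fibre 1) (X'.fibre 0)) (k : ℕ) (f : C(I, B)) :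
    X' →ₗ[ℂ] glueSpace U :=
  glueOfVanishing U ∘ₗ (rmul X' (cutoff k • f)).codRestrict (X'.vanishing 0)
    fun ξ => op_smul_mem_vanishing_of_apply_eq_zero (cutoff_smul_apply_zero k f) ξ

theorem norm_glueCutoff_le (k : ℕ) (f : C(I, B)) (ξ : X') :
    ‖glueCutoff U k f ξ‖ ≤ ‖ξ‖ * ‖cutoff k • f‖ :=
  (norm_glueOfVanishing _).trans_le (norm_op_smul_le _ _)

theorem continuous_glueCutoff (k : ℕ) (f : C(I, B)) : Continuous (glueCutoff U k f) :=
  AddMonoidHomClass.continuous_of_bound _ ‖cutoff k • f‖ fun ξ =>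
    (norm_glueCutoff_le k f ξ).trans_eq (mul_comm _ _)

theorem cutoff_smul_mul (k : ℕ) (f g : C(I, B)) :
    (cutoff k • f) * g = cutoff k • (f * g) := by
  ext t
  exact smul_mul_assoc (cutoff k t) (f t) (g t)

theorem mul_cutoff_smul (k : ℕ) (f g : C(I, B)) :
    f * (cutoff k • g) = cutoff k • (f * g) := by
  ext t
  exact mul_smul_comm (cutoff k t) (f t) (g t)

theorem glueCutoff_op_smul (k : ℕ) (f g : C(I, B)) (ξ : X') :
    glueCutoff U k f (op g • ξ) = glueCutoff U k (g * f) ξ := by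
  refine Subtype.ext (Prod.ext rfl ?_)
  show op (cutoff k • f) • op g • ξ = op (cutoff k • (g * f)) • ξ
  rw [← op_mul_smul, mul_cutoff_smul]

theorem op_smul_glueCutoff (k : ℕ) (f g : C(I, B)) (ξ : X') :
    op g • glueCutoff U k f ξ = glueCutoff U k (f * beta1 g) ξ := by
  refine Subtype.ext (Prod.ext (map_zero (rmul X (beta0 g))) ?_)
  show op (beta1 g) • op (cutoff k • f) • ξ = op (cutoff k • (f * beta1 g)) • ξ
  rw [← op_mul_smul, cutoff_smul_mul]

variable (U) in
/-- The glued correspondence is countably generated when `X` and `X'` are. -/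
theorem isCountablyGenerated_glue (hX : X.IsCountablyGenerated) (hX' : X'.IsCountablyGenerated) :
    (glue U).IsCountablyGenerated := by
  obtain ⟨S, hS, hSd⟩ := hX
  obtain ⟨S', hS', hSd'⟩ := hX'
  choose lift hlift using exists_glue_fst U
  have happ : ∀ (ξ : X') (m : ℕ), ∃ g : C(I, B), ‖ξ - op g • ξ‖ ≤ 1 / (m + 1) := fun ξ m => by
    obtain ⟨g, hg, -⟩ := exists_approx (B := C(I, B)) ξ (r := (1 / (m + 1)) ^ 2) (by positivity)
    exact ⟨g, le_of_sq_le_sq hg (by positivity)⟩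
  choose unit hunit using happ
  -- The coefficients `unit s m` replace a unit of `C(I, B)`, which need not exist; two natural
  -- number indices keep the family countable.
  let G : Set (glueSpace U) :=
    lift '' S ∪ ⋃ s ∈ S', Set.range fun q : ℕ × ℕ => glueCutoff U q.1 (unit s q.2) s
  let N : Submodule ℂ (glueSpace U) := (Submodule.span ℂ
    {y : glueSpace U | ∃ x ∈ G, ∃ b : C(I, B), y = op b • x}).topologicalClosure
  have hNc : IsClosed (N : Set (glueSpace U)) := Submodule.isClosed_topologicalClosure _
  have hN : ∀ x ∈ G, ∀ b : C(I, B), op b • x ∈ N := fun x hx b =>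
    Submodule.le_topologicalClosure _ (Submodule.subset_span ⟨x, hx, b, rfl⟩)
  -- the vectors `(0, s φₖ f)` with `s` a generator of `X'`
  have h1 : ∀ s ∈ S', ∀ k f, glueCutoff U k f s ∈ N := fun s hs k f => by
    obtain ⟨h, hh⟩ := beta1_surjective f
    -- With `f = β₁ h`, this vector is the generator `(0, s φₖ (unit s m))` times `h`.
    have hmem : ∀ m, glueCutoff U k f (op (unit s m) • s) ∈ N := fun m => by
      rw [glueCutoff_op_smul, ← hh, ← op_smul_glueCutoff]
      exact hN _ (Or.inr (Set.mem_biUnion hs ⟨(k, m), rfl⟩)) h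
    have hlim : Tendsto (fun m => op (unit s m) • s) atTop (𝓝 s) := by
      rw [tendsto_iff_norm_sub_tendsto_zero]
      refine squeeze_zero (fun _ => norm_nonneg _) (fun m => ?_)
        tendsto_one_div_add_atTop_nhds_zero_nat
      rw [norm_sub_rev]
      exact hunit s m
    exact hNc.mem_of_tendsto (((continuous_glueCutoff k f).tendsto s).comp hlim)
      (Eventually.of_forall hmem)
  have h2 : ∀ (ξ : X') k f, glueCutoff U k f ξ ∈ N := fun ξ k f => by
    have hle : Submodule.span ℂ {y : X' | ∃ x ∈ S', ∃ b : C(I, B), y = op b • x} ≤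
        N.comap (glueCutoff U k f) := by
      refine Submodule.span_le.2 ?_
      rintro _ ⟨s, hs, b, rfl⟩
      show glueCutoff U k f (op b • s) ∈ N
      rw [glueCutoff_op_smul]
      exact h1 s hs _ _
    have hcl : IsClosed ((glueCutoff U k f) ⁻¹' (N : Set (glueSpace U))) :=
      hNc.preimage (continuous_glueCutoff k f)
    exact closure_minimal hle hcl (hSd' ξ)
  have h3 : ∀ (ξ : X') (g : C(I, B)) (hg : g 0 = 0),
      glueOfVanishing U ⟨op g • ξ, op_smul_mem_vanishing_of_apply_eq_zero hg ξ⟩ ∈ N := by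
    intro ξ g hg
    refine hNc.closure_subset (Metric.mem_closure_iff.2 fun ε hε => ?_)
    obtain ⟨k, hk⟩ := exists_norm_sub_cutoff_smul_le hg (ε := ε / 2 / (‖ξ‖ + 1)) (by positivity)
    refine ⟨_, h2 ξ k g, ?_⟩
    rw [dist_eq_norm]
    calc _ = ‖op (g - cutoff k • g) • ξ‖ := by
          rw [sub_op_smul]
          exact (congrArg norm (map_sub (glueOfVanishing U) _ _).symm).trans
            (norm_glueOfVanishing _)
      _ ≤ ‖ξ‖ * ‖g - cutoff k • g‖ := norm_op_smul_le _ _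
      _ ≤ (‖ξ‖ + 1) * (ε / 2 / (‖ξ‖ + 1)) := by gcongr; linarith
      _ = ε / 2 := mul_div_cancel₀ _ (by positivity)
      _ < ε := by linarith
  have h4 : ∀ ξ ∈ Submodule.span ℂ {y : X | ∃ x ∈ S, ∃ b : C(I, B), y = op b • x},
      ∃ p ∈ N, p.1.1 = ξ := by
    have hle : Submodule.span ℂ {y : X | ∃ x ∈ S, ∃ b : C(I, B), y = op b • x} ≤
        N.map (LinearMap.fst ℂ X X' ∘ₗ (glueSpace U).subtype) := by
      refine Submodule.span_le.2 ?_
      rintro _ ⟨s, hs, b, rfl⟩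
      obtain ⟨h, rfl⟩ := beta0_surjective b
      exact ⟨_, hN _ (Or.inl ⟨s, hs, rfl⟩) h, congrArg (op (beta0 h) • ·) (hlift s)⟩
    exact hle
  refine ⟨G, (hS.image _).union (hS'.biUnion fun s _ => Set.countable_range _), ?_⟩
  suffices h : ∀ p : glueSpace U, p ∈ N from fun p => h p
  intro p
  refine hNc.closure_subset (Metric.mem_closure_iff.2 fun ε hε => ?_)
  obtain ⟨ξ, hξ, hpξ⟩ := Metric.mem_closure_iff.1 (hSd p.1.1) (ε / 2) (by positivity)
  obtain ⟨q, hq, rfl⟩ := h4 ξ hξ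
  rw [dist_eq_norm] at hpξ
  -- The first coordinate of `p - q` is small, hence so is the second at `0`. This is the threshold
  -- under which `exists_approx` supplies `g` with `g 0 = 0`.
  have hζ : ‖ip C(I, B) (p - q).1.2 (p - q).1.2 0‖ ≤ (ε / 2) ^ 2 := by
    rw [← norm_toFibre_sq, norm_toFibre_glue]
    exact pow_le_pow_left₀ (norm_nonneg _) ((norm_toFibre_le _ _).trans hpξ.le) 2
  obtain ⟨g, hg, hg'⟩ := exists_approx (B := C(I, B)) (p - q).1.2 (r := (ε / 2) ^ 2) (by positivity)
  have hg0 : g 0 = 0 :=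
    hg' (evalHom ℝ 0) (continuous_evalHom 0) (ip_self_nonneg (B := C(I, B)) (p - q).1.2 0) hζ
  -- Adding `(0, ζ g)`, with `ζ` the second coordinate of `p - q`, repairs the second coordinate of
  -- `q` and leaves the first unchanged.
  refine ⟨q + _, N.add_mem hq (h3 (p - q).1.2 g hg0), ?_⟩
  rw [dist_eq_norm, ← sub_sub, norm_glue]
  refine max_lt ?_ ?_
  · refine lt_of_le_of_lt (le_of_eq ?_) (hpξ.trans (half_lt_self hε))
    exact congrArg norm (sub_zero (p.1.1 - q.1.1))
  · exact (le_of_sq_le_sq hg (by positivity)).trans_lt (half_lt_self hε)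

end CountablyGenerated

/-! ### Compactness of the restricted direct sum -/

section Compact

theorem glue_finiteRank_fst {n : ℕ} (p q : Fin n → glueSpace U) (z : glueSpace U) :
    (finiteRank C(I, B) p q z).1.1 =
      finiteRank C(I, B) (fun i => (p i).1.1) (fun i => (q i).1.1) z.1.1 := by
  rw [finiteRank_apply, finiteRank_apply]
  refine (map_sum (LinearMap.fst ℂ X X' ∘ₗ (glueSpace U).subtype) _ _).trans
    (Finset.sum_congr rfl fun i _ => ?_)
  show op (beta0 (ip C(I, B) (q i) z)) • (p i).1.1 = _
  exact congrArg (fun f => op f • (p i).1.1) (beta0_inner U (q i) z)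

theorem glue_finiteRank_snd {n : ℕ} (p q : Fin n → glueSpace U) (z : glueSpace U) :
    (finiteRank C(I, B) p q z).1.2 =
      finiteRank C(I, B) (fun i => (p i).1.2) (fun i => (q i).1.2) z.1.2 := by
  rw [finiteRank_apply, finiteRank_apply]
  refine (map_sum (LinearMap.snd ℂ X X' ∘ₗ (glueSpace U).subtype) _ _).trans
    (Finset.sum_congr rfl fun i _ => ?_)
  show op (beta1 (ip C(I, B) (q i) z)) • (p i).1.2 = _
  exact congrArg (fun f => op f • (p i).1.2) (beta1_inner U (q i) z)

variable (U) in
/-- The restriction of `T ⊕ T'` to `X ×_U X'`. -/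
def glueMap (T : X →L[ℂ] X) (T' : X' →L[ℂ] X')
    (h : ∀ p : glueSpace U, (T p.1.1, T' p.1.2) ∈ glueSpace U) : glueSpace U →L[ℂ] glueSpace U :=
  ((T.prodMap T').comp (glueSpace U).subtypeL).codRestrict (glueSpace U) h

/-- The gluing carries the maximum norm, so the two coordinates can be approximated separately. -/
theorem norm_glueMap_sub_le {T : X →L[ℂ] X} {T' : X' →L[ℂ] X'}
    (h : ∀ p : glueSpace U, (T p.1.1, T' p.1.2) ∈ glueSpace U) {R : glueSpace U →L[ℂ] glueSpace U}
    {F : X →L[ℂ] X} {F' : X' →L[ℂ] X'} (hF : ∀ p, (R p).1.1 = F p.1.1)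
    (hF' : ∀ p, (R p).1.2 = F' p.1.2) :
    ‖glueMap U T T' h - R‖ ≤ max ‖T - F‖ ‖T' - F'‖ := by
  refine ContinuousLinearMap.opNorm_le_bound _ (le_max_of_le_left (norm_nonneg _)) fun p => ?_
  rw [norm_glue]
  refine max_le ?_ ?_
  · have e : ((glueMap U T T' h - R) p).1.1 = (T - F) p.1.1 :=
      congrArg (T p.1.1 - ·) (hF p)
    rw [e]
    refine ((T - F).le_opNorm _).trans ?_
    gcongr
    · exact le_max_left _ _
    · exact le_max_left _ _
  · have e : ((glueMap U T T' h - R) p).1.2 = (T' - F') p.1.2 :=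
      congrArg (T' p.1.2 - ·) (hF' p)
    rw [e]
    refine ((T' - F').le_opNorm _).trans ?_
    gcongr
    · exact le_max_right _ _
    · exact le_max_right _ _

/-- Operators compatible with the gluing have compatible adjoints. -/
theorem adjoint_mem_glueSpace {T S : X →L[ℂ] X} {T' S' : X' →L[ℂ] X'}
    (hT : IsAdjointPairOn C(I, B) T S) (hT' : IsAdjointPairOn C(I, B) T' S')
    (h : ∀ p : glueSpace U, (T p.1.1, T' p.1.2) ∈ glueSpace U) (p : glueSpace U) :
    (S p.1.1, S' p.1.2) ∈ glueSpace U := by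
  show U.toEquiv (X.toFibre 1 (S p.1.1)) = X'.toFibre 0 (S' p.1.2)
  -- Test against the second coordinate of some `q` in the gluing: the adjoint moves to `T'` on `q`,
  -- crosses `U` by `h`, and moves back to `S`.
  refine ip_ext (B := B) fun z => ?_
  obtain ⟨η', rfl⟩ := toFibre_surjective 0 z
  obtain ⟨q, rfl⟩ := exists_glue_snd U η'
  have hq : U.toEquiv (X.toFibre 1 (T q.1.1)) = X'.toFibre 0 (T' q.1.2) := h q
  rw [ip_toFibre, ← hT', ← ip_toFibre, ← hq, ← glue_eq, ← glue_eq, U.map_ip, U.map_ip, ip_toFibre,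
    ip_toFibre, hT]

theorem isAdjointPairOn_glueMap {T S : X →L[ℂ] X} {T' S' : X' →L[ℂ] X'}
    (hT : IsAdjointPairOn C(I, B) T S) (hT' : IsAdjointPairOn C(I, B) T' S')
    (h : ∀ p : glueSpace U, (T p.1.1, T' p.1.2) ∈ glueSpace U)
    (h' : ∀ p : glueSpace U, (S p.1.1, S' p.1.2) ∈ glueSpace U) :
    IsAdjointPairOn C(I, B) (glueMap U T T' h) (glueMap U S S' h') := fun p q => by
  apply ext_halves
  · exact (beta0_inner U _ _).trans ((hT _ _).trans (beta0_inner U p (glueMap U S S' h' q)).symm)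
  · exact (beta1_inner U _ _).trans ((hT' _ _).trans (beta1_inner U p (glueMap U S S' h' q)).symm)

variable (U) in
/-- A finite sum of rank one operators on `X` lifts to one on `X ×_U X'`. -/
theorem exists_glue_finiteRank {n : ℕ} (x y : Fin n → X) :
    ∃ G ∈ Submodule.span ℂ
        {R : glueSpace U →L[ℂ] glueSpace U | ∃ x y : glueSpace U, R = rankOne C(I, B) x y},
      ∃ x' y' : Fin n → X', (∀ p, (G p).1.1 = finiteRank C(I, B) x y p.1.1) ∧
        ∀ p, (G p).1.2 = finiteRank C(I, B) x' y' p.1.2 := by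
  choose lift hlift using exists_glue_fst U
  refine ⟨finiteRank C(I, B) (fun i => lift (x i)) (fun i => lift (y i)),
    finiteRank_mem_span _ _, _, _, fun p => ?_, glue_finiteRank_snd _ _⟩
  rw [glue_finiteRank_fst]
  simp only [hlift]

variable (U) in
/-- A finite sum of rank one operators on `X'` with cut off coefficients extends by zero to
`X ×_U X'`. -/
theorem exists_glue_cutoff_finiteRank {n : ℕ} (x y : Fin n → X') (g : Fin n → C(I, B)) (k : ℕ) :
    ∃ H ∈ Submodule.span ℂ
        {R : glueSpace U →L[ℂ] glueSpace U | ∃ x y : glueSpace U, R = rankOne C(I, B) x y},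
      (∀ p, (H p).1.1 = 0) ∧
        ∀ p, (H p).1.2 = finiteRank C(I, B) (fun i => op (cutoff k • g i) • x i) y p.1.2 := by
  choose lift hlift using exists_glue_snd U
  -- The first coordinates of `lift (y i)` are irrelevant: they enter only coefficients acting on
  -- vectors with first coordinate `0`.
  refine ⟨finiteRank C(I, B) (fun i => glueCutoff U k (g i) (x i)) (fun i => lift (y i)),
    finiteRank_mem_span _ _, fun p => ?_, fun p => ?_⟩
  · rw [glue_finiteRank_fst, finiteRank_apply]
    exact Finset.sum_eq_zero fun i _ => map_zero (rmul X _)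
  · rw [glue_finiteRank_snd]
    simp only [hlift]
    rfl

theorem sub_mem_glueSpace {T F : X →L[ℂ] X} {T' F' : X' →L[ℂ] X'}
    (h : ∀ p : glueSpace U, (T p.1.1, T' p.1.2) ∈ glueSpace U) {R : glueSpace U →L[ℂ] glueSpace U}
    (hF : ∀ p, (R p).1.1 = F p.1.1) (hF' : ∀ p, (R p).1.2 = F' p.1.2) (p : glueSpace U) :
    ((T - F) p.1.1, (T' - F') p.1.2) ∈ glueSpace U := by
  have h1 := (glueSpace U).sub_mem (h p) (R p).2
  have h2 : (T p.1.1, T' p.1.2) - (R p).1 = ((T - F) p.1.1, (T' - F') p.1.2) :=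
    Prod.ext (congrArg (T p.1.1 - ·) (hF p)) (congrArg (T' p.1.2 - ·) (hF' p))
  rwa [h2] at h1

/-- Compatibility says that `U` intertwines `D ⊗ 1` at `1` with `D' ⊗ 1` at `0`, and every vector of
`X'` is the second coordinate of a glued pair. -/
theorem fibreBound_of_glue {D : X →L[ℂ] X} {D' : X' →L[ℂ] X'} {r : ℝ}
    (h : ∀ p : glueSpace U, (D p.1.1, D' p.1.2) ∈ glueSpace U) (hD : FibreBound 1 D r) :
    FibreBound 0 D' r := fun ξ' => by
  obtain ⟨p, rfl⟩ := exists_glue_snd U ξ'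
  rw [norm_toFibre_glue]
  exact (norm_toFibre_glue ⟨_, h p⟩).trans_le (hD _)

set_option maxHeartbeats 1000000 in
/-- The restriction to `X ×_U X'` of a compatible pair of compact operators is compact. -/
theorem glueMap_mem_closure {T S : X →L[ℂ] X} {T' S' : X' →L[ℂ] X'}
    (hT : IsAdjointPairOn C(I, B) T S) (hT' : IsAdjointPairOn C(I, B) T' S')
    (h : ∀ p : glueSpace U, (T p.1.1, T' p.1.2) ∈ glueSpace U)
    (hc : T ∈ closure
      (Submodule.span ℂ {R : X →L[ℂ] X | ∃ x y : X, R = rankOne C(I, B) x y} : Set (X →L[ℂ] X)))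
    (hc' : T' ∈ closure (Submodule.span ℂ
      {R : X' →L[ℂ] X' | ∃ x y : X', R = rankOne C(I, B) x y} : Set (X' →L[ℂ] X'))) :
    glueMap U T T' h ∈ closure (Submodule.span ℂ
      {R : glueSpace U →L[ℂ] glueSpace U | ∃ x y : glueSpace U, R = rankOne C(I, B) x y} :
        Set (glueSpace U →L[ℂ] glueSpace U)) := by
  refine (Metric.mem_closure_iff (α := glueSpace U →L[ℂ] glueSpace U)).2 fun ε hε => ?_
  -- The errors will be less than `δ` on `X` and at most `4 δ` on `X'`, both below `5 δ = ε`.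
  set δ := ε / 5 with hδ
  have hδ0 : 0 < δ := by positivity
  obtain ⟨F, hFs, hF⟩ := Metric.mem_closure_iff.1 hc δ hδ0
  obtain ⟨n, x, y, rfl⟩ := exists_finiteRank_eq hFs
  rw [dist_eq_norm] at hF
  obtain ⟨G, hGs, u, v, hG1, hG2⟩ := exists_glue_finiteRank U x y
  set F' := finiteRank C(I, B) u v
  have hadjF := hT.sub (isAdjointPairOn_finiteRank x y)
  have hadjD : IsAdjointPairOn C(I, B) (T' - F') _ := hT'.sub (isAdjointPairOn_finiteRank _ _)
  have hD : FibreBound 0 (T' - F') δ := fibreBound_of_glue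
    (fun p => sub_mem_glueSpace h hG1 hG2 p) ((FibreBound.of_isAdjointPairOn hadjF).mono hF.le)
  have hDc : T' - F' ∈ closure (Submodule.span ℂ
      {R : X' →L[ℂ] X' | ∃ x y : X', R = rankOne C(I, B) x y} : Set (X' →L[ℂ] X')) := by
    have h1 := (Submodule.span ℂ
      {R : X' →L[ℂ] X' | ∃ x y : X', R = rankOne C(I, B) x y}).topologicalClosure.sub_mem hc'
      (Submodule.le_topologicalClosure _ (finiteRank_mem_span (B := C(I, B)) u v))
    exact h1
  obtain ⟨m, x', y', g, k, hk⟩ := exists_cutoff_norm_sub_le hadjD hDc hδ0 hD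
  obtain ⟨H, hHs, hH1, hH2⟩ := exists_glue_cutoff_finiteRank U x' y' g k
  set H' := finiteRank C(I, B) (fun i => op (cutoff k • g i) • x' i) y'
  -- `G` handles `X` and imposes `F'` on `X'`; `H` approximates the remainder `T' - F'` without
  -- touching `X`.
  refine ⟨G + H, Submodule.add_mem _ hGs hHs, ?_⟩
  refine lt_of_eq_of_lt (dist_eq_norm (E := glueSpace U →L[ℂ] glueSpace U) _ _) ?_
  have hR1 : ∀ p, ((G + H) p).1.1 = finiteRank C(I, B) x y p.1.1 := fun p =>
    (congrArg₂ (· + ·) (hG1 p) (hH1 p)).trans (add_zero _)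
  have hR2 : ∀ p, ((G + H) p).1.2 = (F' + H') p.1.2 := fun p =>
    congrArg₂ (· + ·) (hG2 p) (hH2 p)
  refine (norm_glueMap_sub_le h hR1 hR2).trans_lt (max_lt (by linarith) ?_)
  rw [← sub_sub]
  exact hk.trans_lt (by linarith)

end Compact

end Glue

end GradedCorrespondence

/-! ### The main theorem -/

theorem lemma4p5 {A : Type u} {B : Type v} [NonUnitalCStarAlgebra A] [GradedCStarAlgebra A]
    [TopologicalSpace.SeparableSpace A]
    [NonUnitalCStarAlgebra B] [PartialOrder B] [StarOrderedRing B] [GradedCStarAlgebra B]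
    (hB : IsSigmaUnital B)
    (X : GradedCorrespondence.{u, v, w} A C(I, B)) (X' : GradedCorrespondence.{u, v, w'} A C(I, B))
    (hX : X.IsCountablyGenerated) (hX' : X'.IsCountablyGenerated)
    (U : GradedCorrespondence.EvenUnitary (X.fibre 1) (X'.fibre 0)) :
    (GradedCorrespondence.glue U).IsCountablyGenerated ∧
    ∀ (K : X.Adjointable) (K' : X'.Adjointable), K.IsCompact → K'.IsCompact →
      (∀ y : X'.fibre 0, U.toEquiv (K.fibre 1 (U.toEquiv.symm y)) = K'.fibre 0 y) →
      ∃ L : (GradedCorrespondence.glue U).Adjointable, L.IsCompact ∧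
        ∀ p : GradedCorrespondence.glue U, GradedCorrespondence.glueVal U (L p) =
          (K (GradedCorrespondence.glueVal U p).1, K' (GradedCorrespondence.glueVal U p).2) := by
  refine ⟨GradedCorrespondence.isCountablyGenerated_glue U hX hX', fun K K' hK hK' hKK' => ?_⟩
  obtain ⟨S, hS⟩ := K.exists_adjoint
  obtain ⟨S', hS'⟩ := K'.exists_adjoint
  have h : ∀ p : GradedCorrespondence.glueSpace U,
      (K p.1.1, K' p.1.2) ∈ GradedCorrespondence.glueSpace U := fun p => by
    show U.toEquiv (X.toFibre 1 (K p.1.1)) = X'.toFibre 0 (K' p.1.2)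
    -- On a glued pair `U*` sends `ξ' ⊗ 1` back to `ξ ⊗ 1`, so conjugation by `U` becomes the gluing
    -- condition for `(K ξ, K' ξ')`.
    have h1 := hKK' (X'.toFibre 0 p.1.2)
    rwa [← GradedCorrespondence.glue_eq, LinearEquiv.symm_apply_apply,
      GradedCorrespondence.glue_eq] at h1
  exact ⟨⟨GradedCorrespondence.glueMap U K.toCLM K'.toCLM h, _,
    GradedCorrespondence.isAdjointPairOn_glueMap hS hS' h
      (GradedCorrespondence.adjoint_mem_glueSpace hS hS' h)⟩,
    GradedCorrespondence.glueMap_mem_closure hS hS' h hK hK', fun _ => rfl⟩
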